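/- Let $n\ge 1$, let $\underline{\alpha}=(\alpha_1,\dots,\alpha_n)\in\mathbb{R}^n$ and $\underline{a}=(a_1,\dots,a_n)\in\mathbb{R}_+^n$ (that is, $a_i\ge 0$), and assume that $\sum_{j=1}^{i}(\alpha_j+a_j)>0$ for every $1\le i\le n$. For $\underline{s}\in\mathbb{C}^n$ put $$Y_{n,\underline{a}}(\underline{\alpha};\underline{s})=\int_{\prod_{i=1}^n[\alpha_i,+\infty[}\ \prod_{i=1}^n (x_1+\dots+x_i+a_1+\dots+a_i)^{-s_i}\,d\underline{x}.$$ This integral converges absolutely when $\Re(s_j+\dots+s_n)>n-j+1$ for all $1\le j\le n$, and it has an analytic continuation, again denoted $Y_{n,\underline{a}}(\underline{\alpha};\underline{s})$, to the complement of the possible polar divisors, i.e. of the set of all $\underline{s}$ such that $\prod_{j=1}^{n}\bigl(\sum_{i=j}^n s_i-n+j-1+\sum_{i=j+1}^n k_i\bigr)=0$ for some $(k_2,\dots,k_n)\in\mathbb{N}^{n-1}$, where $\mathbb{N}=\{0,1,2,\dots\}$. Let $\underline{N}=(N_1,\dots,N_n)\in\mathbb{N}^n$. Then the value of the continuation at $\underline{s}=-\underline{N}$,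 understood as the iterated limit $$Y_{n,\underline{a}}(\underline{\alpha};-\underline{N}):=\lim_{s_1\to -N_1}\Bigl(\lim_{s_2\to -N_2}\bigl(\cdots\lim_{s_n\to -N_n}Y_{n,\underline{a}}(\underline{\alpha};\underline{s})\cdots\bigr)\Bigr)$$ (limits in punctured neighbourhoods), exists and is the following polynomial in $a_1,\dots,a_n$: $$Y_{n,\underline{a}}(\underline{\alpha};-\underline{N})=(-1)^n\sum_{\underline{k}\in T(\underline{N})}\ \sum_{\underline{v}}\ A_{\underline{k},\underline{v}}(-\underline{N})\,\frac{a_1^{v_1}}{D_1}\prod_{j=2}^n\frac{a_j^{v_j}}{D_j},$$ where $$D_j=\sum_{i=j}^n N_i+n-j+1-\sum_{i=j+1}^n k_i\qquad(1\le j\le n),$$ $$T(\underline{N})=\{\underline{k}=(k_2,\dots,k_n)\in\mathbb{N}^{n-1}:\ k_j\le D_j\ \text{ for all } 2\le j\le n\},$$ the inner sum runs over all $\underline{v}=(v_1,\dots,v_n)\in\mathbb{N}^n$ with $v_1\le D_1$ and $v_j\le k_j$ for $2\le j\le n$, and $$A_{\underline{k},\underline{v}}(-\underline{N})=\binom{D_1}{v_1}\alpha_1^{D_1-v_1}\prod_{j=2}^n\binom{D_j}{k_j}\binom{k_j}{v_j}\alpha_j^{k_j-v_j}$$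 (with $0^0=1$). For $\underline{k}\in T(\underline{N})$ all $D_j$ are positive integers. -/

import Mathlib

open Filter Topology MeasureTheory

namespace ShiftedIntegral

/-- The integrand `∏ i, (x_1 + ⋯ + x_i + a_1 + ⋯ + a_i) ^ (-s_i)`. -/
noncomputable def integrand {n : ℕ} (a : Fin n → ℝ) (s : Fin n → ℂ) (x : Fin n → ℝ) : ℂ :=
  ∏ i, ((∑ j ∈ Finset.Iic i, (x j + a j) : ℝ) : ℂ) ^ (-s i)

/-- The integral `Y_{n,a}(α; s)` over `∏ i, [α_i, +∞)`, meaningful where it converges absolutely. -/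
noncomputable def Y {n : ℕ} (α a : Fin n → ℝ) (s : Fin n → ℂ) : ℂ :=
  ∫ x in Set.Ici α, integrand a s x

/-- The region of absolute convergence: with one-based indices,
`Re (s_j + ⋯ + s_n) > n - j + 1` for every `j`. -/
def convergenceRegion (n : ℕ) : Set (Fin n → ℂ) :=
  {s | ∀ j : Fin n, (n : ℝ) - (j : ℕ) < (∑ i ∈ Finset.Ici j, s i).re}

/-- The possible polar divisors: with one-based indices, the points `s` with
`∏ j, (s_j + ⋯ + s_n - n + j - 1 + k_{j+1} + ⋯ + k_n) = 0` for some natural numbers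
`k_2, …, k_n` (the first entry of `k` plays no role). -/
def polarSet (n : ℕ) : Set (Fin n → ℂ) :=
  {s | ∃ k : Fin n → ℕ,
    ∏ j : Fin n, ((∑ i ∈ Finset.Ici j, s i) - (n : ℂ) + ((j : ℕ) : ℂ)
      + ∑ i ∈ Finset.Ioi j, (k i : ℂ)) = 0}

/-- `F` is the analytic continuation of `s ↦ Y_{n,a}(α; s)` to the complement of the possible
polar divisors. -/
structure IsContinuation {n : ℕ} (α a : Fin n → ℝ) (F : (Fin n → ℂ) → ℂ) : Prop where
  holomorphic : DifferentiableOn ℂ F (polarSet n)ᶜ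
  eq_integral : ∀ s ∈ convergenceRegion n, F s = Y α a s

/-- `HasIteratedLimit n f p L` says that
`lim_{s_1 → p_1} (lim_{s_2 → p_2} (⋯ (lim_{s_n → p_n} f (s_1, …, s_n)) ⋯ )) = L`,
all limits being limits in punctured neighbourhoods; each inner limit is only asked to exist
for the outer variable in some punctured neighbourhood of its limit point. -/
def HasIteratedLimit : (n : ℕ) → ((Fin n → ℂ) → ℂ) → (Fin n → ℂ) → ℂ → Prop
  | 0, f, p, L => f p = L
  | n + 1, f, p, L => ∃ g : ℂ → ℂ,
      (∀ᶠ z in 𝓝[≠] (p 0),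
        HasIteratedLimit n (fun t => f (Fin.cons z t)) (Fin.tail p) (g z)) ∧
      Tendsto g (𝓝[≠] (p 0)) (𝓝 L)

/-- With one-based indices, `D_j = (N_j + ⋯ + N_n) + n - j + 1 - (k_{j+1} + ⋯ + k_n)`.
For `k ∈ T N` the subtraction does not truncate, see `add_sum_eq_of_mem_T`. -/
def D {n : ℕ} (N k : Fin n → ℕ) (j : Fin n) : ℕ :=
  (∑ i ∈ Finset.Ici j, N i) + (n - (j : ℕ)) - ∑ i ∈ Finset.Ioi j, k i

/-- The index set `T(N)` of the `(k_2, …, k_n)` with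
`k_j ≤ (N_j + ⋯ + N_n) + n - j + 1 - (k_{j+1} + ⋯ + k_n)` for `2 ≤ j ≤ n`.
A tuple is stored as `k : Fin n → ℕ` with the dummy first entry `0`; the bounding box only
serves to obtain a `Finset`, see `mem_T`. -/
def T {n : ℕ} [NeZero n] (N : Fin n → ℕ) : Finset (Fin n → ℕ) :=
  (Fintype.piFinset fun _ : Fin n => Finset.range ((∑ i, N i) + n + 1)).filter fun k =>
    k 0 = 0 ∧ ∀ j : Fin n, j ≠ 0 →
      k j + ∑ i ∈ Finset.Ioi j, k i ≤ (∑ i ∈ Finset.Ici j, N i) + (n - (j : ℕ))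

theorem mem_T {n : ℕ} [NeZero n] (N k : Fin n → ℕ) :
    k ∈ T N ↔ k 0 = 0 ∧ ∀ j : Fin n, j ≠ 0 →
      k j + ∑ i ∈ Finset.Ioi j, k i ≤ (∑ i ∈ Finset.Ici j, N i) + (n - (j : ℕ)) := by
  simp only [T, Finset.mem_filter, Fintype.mem_piFinset, Finset.mem_range, and_iff_right_iff_imp]
  rintro ⟨h0, h⟩ j
  by_cases hj : j = 0
  · subst hj; omega
  · have h1 := h j hj
    have h2 : ∑ i ∈ Finset.Ici j, N i ≤ ∑ i, N i :=
      Finset.sum_le_sum_of_subset (Finset.subset_univ _)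
    omega

/-- For `k ∈ T N` the number `D_j` is the true difference, and it is positive. -/
theorem add_sum_eq_of_mem_T {n : ℕ} [NeZero n] {N k : Fin n → ℕ} (hk : k ∈ T N) (j : Fin n) :
    D N k j + ∑ i ∈ Finset.Ioi j, k i = (∑ i ∈ Finset.Ici j, N i) + (n - (j : ℕ)) ∧
      0 < D N k j := by
  rw [mem_T] at hk
  have hlt := j.isLt
  suffices h : ∑ i ∈ Finset.Ioi j, k i < (∑ i ∈ Finset.Ici j, N i) + (n - (j : ℕ)) by
    unfold D; omega
  by_cases hn : (j : ℕ) + 1 < n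
  · let j' : Fin n := ⟨j + 1, hn⟩
    have hIoi : Finset.Ioi j = insert j' (Finset.Ioi j') := by
      ext i
      simp only [Finset.mem_Ioi, Finset.mem_insert, Fin.lt_def, Fin.ext_iff, j']
      omega
    have hIci : ∑ i ∈ Finset.Ici j', N i ≤ ∑ i ∈ Finset.Ici j, N i :=
      Finset.sum_le_sum_of_subset (Finset.Ici_subset_Ici.2 (by simp [Fin.le_def, j']))
    have h0 : j' ≠ 0 := by
      intro h
      have := congrArg Fin.val h
      simp [j'] at this
    have h1 := hk.2 j' h0
    rw [hIoi, Finset.sum_insert (by simp)]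
    have h2 : (j' : ℕ) = j + 1 := rfl
    omega
  · have hIoi : Finset.Ioi j = ∅ := by
      ext i
      have := i.isLt
      simp only [Finset.mem_Ioi, Fin.lt_def, Finset.notMem_empty, iff_false]
      omega
    rw [hIoi, Finset.sum_empty]
    omega

/-- The indices `v = (v_1, …, v_n)` with `v_1 ≤ D_1` and `v_j ≤ k_j` for `2 ≤ j ≤ n`. -/
def V {n : ℕ} [NeZero n] (N k : Fin n → ℕ) : Finset (Fin n → ℕ) :=
  Fintype.piFinset fun j => Finset.range ((if j = 0 then D N k 0 else k j) + 1)

/-- The coefficient `A(-N)` attached to `k` and `v`. -/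
noncomputable def A {n : ℕ} [NeZero n] (α : Fin n → ℝ) (N k v : Fin n → ℕ) : ℝ :=
  (D N k 0).choose (v 0) * α 0 ^ (D N k 0 - v 0) *
    ∏ j ∈ Finset.Ioi (0 : Fin n),
      ((D N k j).choose (k j) * (k j).choose (v j) * α j ^ (k j - v j))

/-- The explicit polynomial in `a_1, …, a_n`. -/
noncomputable def valuePoly {n : ℕ} [NeZero n] (α : Fin n → ℝ) (N : Fin n → ℕ)
    (a : Fin n → ℝ) : ℝ :=
  (-1) ^ n * ∑ k ∈ T N, ∑ v ∈ V N k,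
    A α N k v * a 0 ^ v 0 / D N k 0 * ∏ j ∈ Finset.Ioi (0 : Fin n), (a j ^ v j / D N k j)

end ShiftedIntegral

/-! Integrating over x_n replaces the last factor by (c + b_n)^(1 - s_n) / (s_n - 1), where c is the
sum of the x_i + a_i with i < n and b_n = α_n + a_n. Expand in powers of b_n: the k-th term is a
multiple of c^(1 - s_n - k), which merges with the factor c^(-s_{n-1}), so its integral is the
(n-1)-variable Y with last exponent s_{n-1} + s_n - 1 + k (`fuse`). After K terms the remainder is
O(c^(Re(1 - s_n) - K)), uniformly for bounded s (`exists_norm_remainder_le`); this needs c and c +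
b_n bounded below by positive constants, but not |b_n| < c. Hence the integral of the remainder is
holomorphic on an open set that grows with K and exhausts ℂ^n. Induction on n gives absolute
convergence (`integrableOn_integrand`) and the continuation (`isContinuation_extendContinuation`),
which is unique by `IsContinuation.eqOn`.

At s_n = -N_n the exponent 1 - s_n is the natural number N_n + 1: the expansion stops, the remainder
vanishes, and the continuation is a finite combination of continuations in n - 1 variables
(`extendContinuation_of_last_eq_neg`). For generic outer variables this point avoids the polar
divisors, so the innermost limit is an evaluation, and the outer limits follow by induction
(`IsContinuation.hasIteratedLimit`). Unrolling the recursion `recValue` gives a sum over T(N) of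
monomials in the b_j = α_j + a_j (`recValue_eq`); expanding the powers of each b_j produces the sum
over v (`sum_V`). -/

namespace ShiftedIntegral

/-! ### Holomorphy of dominated parametric integrals. -/

section ParametricIntegral

variable {X : Type*} [MeasurableSpace X] {μ : Measure X} {n : ℕ} {f : (Fin n → ℂ) → X → ℂ}
  {s₀ : Fin n → ℂ}

/-- Each directional derivative is an a.e. limit of difference quotients with step 1/m, and a linear
form on ℂ^n is determined by its values on the standard basis. -/
theorem aestronglyMeasurable_of_hasFDerivAt {f' : X → (Fin n → ℂ) →L[ℂ] ℂ}
    (hm : ∀ s, AEStronglyMeasurable (f s) μ)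
    (hd : ∀ᵐ x ∂μ, HasFDerivAt (f · x) (f' x) s₀) : AEStronglyMeasurable f' μ := by
  have happ (v : Fin n → ℂ) : AEStronglyMeasurable (fun x => f' x v) μ := by
    refine aestronglyMeasurable_of_tendsto_ae (ι := ℕ) atTop
      (f := fun m x => (m : ℂ) • (f (s₀ + (m : ℂ)⁻¹ • v) x - f s₀ x))
      (fun m => AEStronglyMeasurable.const_smul (f := fun x => f (s₀ + (m : ℂ)⁻¹ • v) x - f s₀ x)
        ((hm _).sub (hm _)) (m : ℂ)) ?_
    filter_upwards [hd] with x hx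
    refine hx.lim v ?_
    simpa using tendsto_natCast_atTop_atTop (R := ℝ)
  have hsum : f' = fun x => ∑ i, (f' x (Pi.single i 1)) •
      (ContinuousLinearMap.proj i : (Fin n → ℂ) →L[ℂ] ℂ) := by
    funext x
    ext v
    conv_lhs => rw [pi_eq_sum_univ' (R := ℂ) v]
    simp [mul_comm]
  rw [hsum]
  exact Finset.aestronglyMeasurable_fun_sum _ fun i _ => (happ _).smul_const _

/-- A dominated integral of entire functions is holomorphic; no bound on the derivative is needed. -/
theorem differentiableAt_integral_of_dominated {r : ℝ} (hr : 0 < r) {g : X → ℝ}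
    (hm : ∀ s, AEStronglyMeasurable (f s) μ) (hd : ∀ᵐ x ∂μ, Differentiable ℂ (f · x))
    (hb : ∀ᵐ x ∂μ, ∀ s ∈ Metric.ball s₀ r, ‖f s x‖ ≤ g x) (hg : Integrable g μ) :
    DifferentiableAt ℂ (fun s => ∫ x, f s x ∂μ) s₀ := by
  refine (hasFDerivAt_integral_of_dominated_of_fderiv_le (𝕜 := ℂ)
    (s := Metric.ball s₀ (r / 2)) (F' := fun s x => fderiv ℂ (f · x) s)
    (bound := fun x => 2 * g x / (r / 2)) (Metric.ball_mem_nhds _ (by positivity))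
    (Eventually.of_forall hm) ?_ ?_ ?_ ?_ ?_).differentiableAt
  · refine hg.mono' (hm _) ?_
    filter_upwards [hb] with x hx using hx _ (Metric.mem_ball_self hr)
  · refine aestronglyMeasurable_of_hasFDerivAt (s₀ := s₀) hm ?_
    filter_upwards [hd] with x hx using (hx s₀).hasFDerivAt
  · filter_upwards [hb, hd] with x hx hdx s hs
    have hsub : Metric.ball s (r / 2) ⊆ Metric.ball s₀ r := by
      refine Metric.ball_subset_ball' ?_
      have := Metric.mem_ball.1 hs
      linarith
    -- Cauchy estimate on the ball of radius r/2 about s: it lies in the ball where g dominates, so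
    -- values there differ from the value at s by at most 2 g(x).
    refine Complex.norm_fderiv_le_div_of_mapsTo_ball hdx.differentiableOn ?_ (by positivity)
    intro s' hs'
    rw [mem_closedBall_iff_norm]
    have h1 := hx _ (hsub hs')
    have h2 := hx _ (hsub (Metric.mem_ball_self (by positivity)))
    linarith [norm_sub_le (f s' x) (f s x)]
  · exact (hg.const_mul 2).div_const _
  · filter_upwards [hd] with x hx s _ using (hx s).hasFDerivAt

end ParametricIntegral

/-! ### Binomial expansion with complex exponent and its remainder. -/

section Taylor

/-- The generalised binomial coefficient `w (w - 1) ⋯ (w - k + 1) / k!`. -/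
noncomputable def binom : ℂ → ℕ → ℂ
  | _, 0 => 1
  | w, k + 1 => w / (k + 1) * binom (w - 1) k

theorem differentiable_binom (k : ℕ) : Differentiable ℂ fun w => binom w k := by
  induction k with
  | zero => simp [binom]
  | succ k ih =>
    simp only [binom]
    exact (differentiable_id.div_const _).mul (ih.comp (differentiable_id.sub_const 1))

theorem binom_natCast (n k : ℕ) : binom n k = n.choose k := by
  induction k generalizing n with
  | zero => simp [binom]
  | succ k ih =>
    cases n with
    | zero => simp [binom]
    | succ n =>
      have h : ((n + 1 : ℕ) : ℂ) * n.choose k = (n + 1).choose (k + 1) * (k + 1 : ℕ) := by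
        exact_mod_cast Nat.add_one_mul_choose_eq n k
      have hk : ((k : ℂ) + 1) ≠ 0 := by exact_mod_cast k.succ_ne_zero
      have h1 : ((n + 1 : ℕ) : ℂ) - 1 = n := by push_cast; ring
      rw [binom, h1, ih, div_mul_eq_mul_div, h]
      push_cast
      field_simp

/-- The remainder of the binomial expansion of `(c + b) ^ w` after `K` terms. -/
noncomputable def remainder (K : ℕ) (w : ℂ) (c b : ℝ) : ℂ :=
  ((c + b : ℝ) : ℂ) ^ w - ∑ k ∈ Finset.range K, binom w k * (b : ℂ) ^ k * (c : ℂ) ^ (w - k)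

theorem remainder_succ (K : ℕ) (w : ℂ) (c b : ℝ) :
    remainder K w c b =
      binom w K * (b : ℂ) ^ K * (c : ℂ) ^ (w - K) + remainder (K + 1) w c b := by
  simp only [remainder, Finset.sum_range_succ]
  ring

theorem remainder_natCast {K M : ℕ} (h : M < K) (c b : ℝ) :
    remainder K M c b = 0 := by
  have hsub : Finset.range (M + 1) ⊆ Finset.range K := Finset.range_subset_range.2 h
  rw [remainder, ← Finset.sum_subset hsub, Complex.cpow_natCast, Complex.ofReal_add,
    add_comm (c : ℂ), add_pow, sub_eq_zero]
  · refine Finset.sum_congr rfl fun k hk => ?_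
    have hk' : k ≤ M := Nat.lt_succ_iff.1 (Finset.mem_range.1 hk)
    rw [binom_natCast, ← Nat.cast_sub hk', Complex.cpow_natCast]
    ring
  · intro k _ hk
    rw [binom_natCast, Nat.choose_eq_zero_of_lt (by simpa using hk)]
    simp

theorem remainder_succ_zero (K : ℕ) (w : ℂ) (c : ℝ) : remainder (K + 1) w c 0 = 0 := by
  rw [remainder, Finset.sum_range_succ']
  simp [binom]

/-- Differentiation lowers both the order and the exponent by one, because (k + 1) binom(w, k + 1) =
w binom(w - 1, k). This makes the remainder estimate an induction on the order. -/
theorem hasDerivAt_remainder (K : ℕ) (w : ℂ) {c b u : ℝ} (h : 0 < c + u * b) :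
    HasDerivAt (fun u : ℝ => remainder (K + 1) w c (u * b))
      (b * w * remainder K (w - 1) c (u * b)) u := by
  have hu : HasDerivAt (fun u : ℝ => ((u * b : ℝ) : ℂ)) b u := by
    simpa using ((hasDerivAt_id u).mul_const b).ofReal_comp
  have hpow (k : ℕ) : HasDerivAt (fun u : ℝ => ((u * b : ℝ) : ℂ) ^ (k + 1))
      (((k + 1 : ℕ) : ℂ) * ((u * b : ℝ) : ℂ) ^ k * b) u := by
    simpa using hu.fun_pow (k + 1)
  have hcp : HasDerivAt (fun u : ℝ => ((c + u * b : ℝ) : ℂ) ^ w)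
      (w * ((c + u * b : ℝ) : ℂ) ^ (w - 1) * b) u := by
    have h1 : HasDerivAt (fun u : ℝ => ((c + u * b : ℝ) : ℂ)) b u := by
      simpa using (((hasDerivAt_id u).mul_const b).const_add c).ofReal_comp
    have h2 := (Complex.hasStrictDerivAt_cpow_const (c := w)
      (Complex.ofReal_mem_slitPlane.2 h)).hasDerivAt
    exact h2.comp u h1
  have hsum := HasDerivAt.fun_sum (u := Finset.range K) (x := u) fun k _ =>
    ((hpow k).const_mul (binom w (k + 1))).mul_const ((c : ℂ) ^ (w - (k + 1 : ℕ)))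
  have htot := hcp.sub (hsum.add_const (c := binom w 0 * (c : ℂ) ^ w))
  refine (htot.congr_of_eventuallyEq (Eventually.of_forall fun v => ?_)).congr_deriv ?_
  · simp only [remainder, Finset.sum_range_succ', Pi.sub_apply]
    simp
  · rw [remainder, mul_sub, Finset.mul_sum]
    congr 1
    · ring
    · refine Finset.sum_congr rfl fun k _ => ?_
      have hk : ((k : ℂ) + 1) ≠ 0 := by exact_mod_cast k.succ_ne_zero
      have he : w - ((k + 1 : ℕ) : ℂ) = w - 1 - k := by push_cast; ring
      rw [he, binom]
      push_cast
      field_simp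

variable {B b : ℝ}

theorem add_mul_pos (hB : 0 < B) (hBb : 0 < B + b) {c t : ℝ} (hc : B ≤ c)
    (ht : t ∈ Set.Icc (0 : ℝ) 1) : 0 < c + t * b := by
  obtain ⟨h0, h1⟩ := ht
  rcases le_total 0 b with hb | hb
  · have := mul_nonneg h0 hb
    linarith
  · nlinarith

/-- `(c + t b) ^ σ` is comparable with `c ^ σ`. -/
theorem exists_rpow_add_le (hB : 0 < B) (hBb : 0 < B + b) (ρ : ℝ) :
    ∃ C, 0 ≤ C ∧ ∀ σ : ℝ, |σ| ≤ ρ → ∀ c, B ≤ c → ∀ t ∈ Set.Icc (0 : ℝ) 1,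
      (c + t * b) ^ σ ≤ C * c ^ σ := by
  -- M bounds both (c + t b)/c and its inverse: the second summand serves the former, the third the
  -- latter when b ≤ 0. The sign of σ decides which ratio is used.
  set M := 1 + |b| / B + |b| / (B + b) with hM
  have hq1 : 0 ≤ |b| / B := by positivity
  have hq2 : 0 ≤ |b| / (B + b) := by positivity
  have hM1 : 1 ≤ M := by linarith
  refine ⟨M ^ ρ, by positivity, fun σ hσ c hc t ht => ?_⟩
  have hc0 : 0 < c := hB.trans_le hc
  have hpos := add_mul_pos hB hBb hc ht
  have hup : (c + t * b) / c ≤ M := by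
    rw [div_le_iff₀ hc0]
    have h1 : t * b ≤ |b| := by nlinarith [le_abs_self b, abs_nonneg b, ht.1, ht.2]
    have h2 : |b| = |b| / B * B := by field_simp
    nlinarith
  have hlow : c / (c + t * b) ≤ M := by
    rw [div_le_iff₀ hpos]
    rcases le_total 0 b with hb | hb
    · have := mul_nonneg ht.1 hb
      nlinarith
    · have h1 : -(t * b) ≤ |b| := by nlinarith [neg_le_abs b, abs_nonneg b, ht.1, ht.2]
      have h2 : |b| = |b| / (B + b) * (B + b) := by field_simp
      have h3 : B + b ≤ c + t * b := by nlinarith [ht.2]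
      nlinarith
  have hσ' := abs_le.1 hσ
  have key : ((c + t * b) / c) ^ σ ≤ M ^ ρ := by
    rcases le_total 0 σ with h | h
    · exact (Real.rpow_le_rpow (by positivity) hup h).trans
        (Real.rpow_le_rpow_of_exponent_le hM1 hσ'.2)
    · have : ((c + t * b) / c) ^ σ = (c / (c + t * b)) ^ (-σ) := by
        rw [← inv_div, Real.inv_rpow (by positivity), ← Real.rpow_neg (by positivity)]
      rw [this]
      exact (Real.rpow_le_rpow (by positivity) hlow (by linarith)).trans
        (Real.rpow_le_rpow_of_exponent_le hM1 (by linarith))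
  rwa [Real.div_rpow hpos.le hc0.le, div_le_iff₀ (by positivity)] at key

/-- The remainder of order K + 1 vanishes at b = 0, so the mean value inequality bounds it by its
derivative, a remainder of order K at w - 1; the exponent Re w - (K + 1) is the same for both. The
parameter t is carried along because the induction needs the bound on the whole segment from 0 to b.
-/
theorem exists_norm_remainder_le_segment (hB : 0 < B) (hBb : 0 < B + b) (K : ℕ) (ρ : ℝ) :
    ∃ C, 0 ≤ C ∧ ∀ w : ℂ, ‖w‖ ≤ ρ → ∀ c, B ≤ c → ∀ t ∈ Set.Icc (0 : ℝ) 1,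
      ‖remainder K w c (t * b)‖ ≤ C * c ^ (w.re - K) := by
  induction K generalizing ρ with
  | zero =>
    obtain ⟨C, hC, h⟩ := exists_rpow_add_le hB hBb ρ
    refine ⟨C, hC, fun w hw c hc t ht => ?_⟩
    simpa [remainder, ← Complex.ofReal_mul, ← Complex.ofReal_add,
      Complex.norm_cpow_eq_rpow_re_of_pos (add_mul_pos hB hBb hc ht)]
      using h w.re ((Complex.abs_re_le_norm w).trans hw) c hc t ht
  | succ K ih =>
    obtain ⟨C, hC, h⟩ := ih (ρ + 1)
    refine ⟨|b| * |ρ| * C, by positivity, fun w hw c hc t ht => ?_⟩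
    have hut {u : ℝ} (hu : u ∈ Set.Icc (0 : ℝ) 1) : u * t ∈ Set.Icc (0 : ℝ) 1 :=
      ⟨mul_nonneg hu.1 ht.1, mul_le_one₀ hu.2 ht.1 ht.2⟩
    have hmv := norm_image_sub_le_of_norm_deriv_le_segment_01'
      (f := fun u : ℝ => remainder (K + 1) w c (u * (t * b)))
      (C := |b| * |ρ| * C * c ^ (w.re - (K + 1 : ℕ)))
      (fun u hu => (hasDerivAt_remainder K w (b := t * b) (u := u) (by
        rw [← mul_assoc]
        exact add_mul_pos hB hBb hc (hut hu))).hasDerivWithinAt) (fun u hu => ?_)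
    · simpa [remainder_succ_zero] using hmv
    · have h1 := h (w - 1) ((norm_sub_le _ _).trans (by simpa using hw)) c hc (u * t)
        (hut ⟨hu.1, hu.2.le⟩)
      have he : (w - 1).re - K = w.re - ((K + 1 : ℕ) : ℝ) := by
        simp only [Complex.sub_re, Complex.one_re]
        push_cast
        ring
      rw [he, mul_assoc] at h1
      rw [norm_mul, norm_mul, Complex.norm_real, Real.norm_eq_abs, mul_assoc (|b| * |ρ|)]
      have hb : |t * b| ≤ |b| := by
        rw [abs_mul, abs_of_nonneg ht.1]
        exact mul_le_of_le_one_left (abs_nonneg _) ht.2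
      have hw' : ‖w‖ ≤ |ρ| := hw.trans (le_abs_self _)
      gcongr

theorem exists_norm_remainder_le (hB : 0 < B) (hBb : 0 < B + b) (K : ℕ) (ρ : ℝ) :
    ∃ C, 0 ≤ C ∧ ∀ w : ℂ, ‖w‖ ≤ ρ → ∀ c, B ≤ c →
      ‖remainder K w c b‖ ≤ C * c ^ (w.re - K) := by
  obtain ⟨C, hC, h⟩ := exists_norm_remainder_le_segment hB hBb K ρ
  exact ⟨C, hC, fun w hw c hc => by simpa using h w hw c hc 1 (by simp)⟩

end Taylor

theorem remainder_zero (w : ℂ) (c b : ℝ) : remainder 0 w c b = ((c + b : ℝ) : ℂ) ^ w := by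
  simp [remainder]

/-! ### Tail sums and the last index. -/

section FinSums

variable {M : Type*} [AddCommMonoid M] {n : ℕ}

theorem sum_Ici_castSucc (f : Fin (n + 1) → M) (j : Fin n) :
    ∑ i ∈ Finset.Ici j.castSucc, f i = ∑ i ∈ Finset.Ici j, f i.castSucc + f (Fin.last n) := by
  simp only [← Finset.filter_le_eq_Ici, Finset.sum_filter, Fin.sum_univ_castSucc,
    Fin.castSucc_le_castSucc_iff, Fin.le_last, if_true]

theorem sum_Ioi_castSucc (f : Fin (n + 1) → M) (j : Fin n) :
    ∑ i ∈ Finset.Ioi j.castSucc, f i = ∑ i ∈ Finset.Ioi j, f i.castSucc + f (Fin.last n) := by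
  simp only [← Finset.filter_lt_eq_Ioi, Finset.sum_filter, Fin.sum_univ_castSucc,
    Fin.castSucc_lt_castSucc_iff, Fin.castSucc_lt_last, if_true]

theorem sum_Ici_last (f : Fin (n + 1) → M) :
    ∑ i ∈ Finset.Ici (Fin.last n), f i = f (Fin.last n) := by
  have : Finset.Ici (Fin.last n) = {Fin.last n} := by ext; simp [Fin.last_le_iff]
  rw [this, Finset.sum_singleton]

theorem sum_Ioi_last (f : Fin (n + 1) → M) : ∑ i ∈ Finset.Ioi (Fin.last n), f i = 0 := by
  have : Finset.Ioi (Fin.last n) = ∅ := by ext i; simp [Fin.le_last]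
  rw [this, Finset.sum_empty]

theorem sum_Iic_last (f : Fin (n + 1) → M) : ∑ i ∈ Finset.Iic (Fin.last n), f i = ∑ i, f i := by
  have : Finset.Iic (Fin.last n) = Finset.univ := by ext i; simp [Fin.le_last]
  rw [this]

end FinSums

/-! ### Positivity of partial sums and the integrand. -/

/-- All partial sums `∑ j ≤ i, (α_j + a_j)` are positive. -/
def PosSums {n : ℕ} (α a : Fin n → ℝ) : Prop :=
  ∀ i, 0 < ∑ j ∈ Finset.Iic i, (α j + a j)

variable {n m : ℕ}

theorem PosSums.init {α a : Fin (n + 1) → ℝ} (h : PosSums α a) :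
    PosSums (n := n) (Fin.init α) (Fin.init a) := fun i => by
  simpa [Fin.sum_Iic_castSucc, Fin.init] using h i.castSucc

theorem PosSums.sum_pos {α a : Fin (n + 1) → ℝ} (h : PosSums α a) : 0 < ∑ i, (α i + a i) := by
  simpa [sum_Iic_last] using h (Fin.last n)

theorem PosSums.of_mem_Ici {α a x : Fin n → ℝ} (h : PosSums α a) (hx : x ∈ Set.Ici α) :
    PosSums x a := fun i =>
  (h i).trans_le (Finset.sum_le_sum fun j _ => add_le_add_left (Set.mem_Ici.1 hx j) _)

theorem measurable_integrand (a : Fin n → ℝ) (s : Fin n → ℂ) : Measurable (integrand a s) := by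
  unfold integrand
  fun_prop

theorem norm_integrand {a x : Fin n → ℝ} (s : Fin n → ℂ) (hx : PosSums x a) :
    ‖integrand a s x‖ = ∏ i, (∑ j ∈ Finset.Iic i, (x j + a j)) ^ (-(s i).re) := by
  rw [integrand, norm_prod]
  refine Finset.prod_congr rfl fun i _ => ?_
  rw [Complex.norm_cpow_eq_rpow_re_of_pos (hx i), Complex.neg_re]

theorem differentiable_integrand {a x : Fin n → ℝ} (hx : PosSums x a) :
    Differentiable ℂ fun s => integrand a s x := by
  have h (i : Fin n) : Differentiable ℂ fun s : Fin n → ℂ =>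
      ((∑ j ∈ Finset.Iic i, (x j + a j) : ℝ) : ℂ) ^ (-s i) := by
    refine Differentiable.const_cpow (by fun_prop) (Or.inl ?_)
    exact_mod_cast (hx i).ne'
  exact fun s => (HasFDerivAt.finsetProd fun i _ => (h i s).hasFDerivAt).differentiableAt

theorem integrand_snoc (a : Fin (n + 1) → ℝ) (s : Fin (n + 1) → ℂ) (x : Fin n → ℝ) (y : ℝ) :
    integrand a s (Fin.snoc x y : Fin (n + 1) → ℝ) =
      integrand (n := n) (Fin.init a) (Fin.init s) x *
        ((∑ i, (x i + a i.castSucc) + (y + a (Fin.last n)) : ℝ) : ℂ) ^ (-s (Fin.last n)) := by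
  simp [integrand, Fin.prod_univ_castSucc, Fin.sum_Iic_castSucc, sum_Iic_last,
    Fin.sum_univ_castSucc, Fin.init]

/-- The last factor is a power of the full sum, so a further power of that sum is absorbed into the
last exponent. -/
theorem integrand_add_single {a x : Fin (n + 1) → ℝ} (hx : PosSums x a) (s : Fin (n + 1) → ℂ)
    (w : ℂ) : integrand a (s + Pi.single (Fin.last n) w) x =
      integrand a s x * ((∑ i, (x i + a i) : ℝ) : ℂ) ^ (-w) := by
  have h0 : ((∑ i, (x i + a i) : ℝ) : ℂ) ≠ 0 := by exact_mod_cast hx.sum_pos.ne'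
  have h1 (i : Fin n) : (Pi.single (Fin.last n) w : Fin (n + 1) → ℂ) i.castSucc = 0 :=
    Pi.single_eq_of_ne (Fin.castSucc_lt_last i).ne _
  simp only [integrand, Fin.prod_univ_castSucc, Pi.add_apply, h1, add_zero, Pi.single_eq_same,
    sum_Iic_last]
  rw [neg_add, Complex.cpow_add _ _ h0, mul_assoc]

/-! ### The integral over the last variable. -/

section OneVariable

variable {c d y₀ : ℝ}

theorem integrableOn_shift_cpow (h : 0 < c + (y₀ + d)) {s : ℂ} (hs : 1 < s.re) :
    IntegrableOn (fun y : ℝ => ((c + (y + d) : ℝ) : ℂ) ^ (-s)) (Set.Ici y₀) := by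
  have hpre : (fun y : ℝ => y + (c + d)) ⁻¹' Set.Ioi (c + (y₀ + d)) = Set.Ioi y₀ := by
    ext y; simp only [Set.mem_preimage, Set.mem_Ioi]; constructor <;> intro h <;> linarith
  have := (measurePreserving_add_right volume (c + d)).integrableOn_comp_preimage
    (measurableEmbedding_addRight (c + d)) (s := Set.Ioi (c + (y₀ + d)))
    (f := fun y : ℝ => (y : ℂ) ^ (-s))
  rw [integrableOn_Ici_iff_integrableOn_Ioi, ← hpre]
  convert! this.2 (integrableOn_Ioi_cpow_of_lt (by simpa using hs) h) using 2 with y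
  simp only [Function.comp_apply]
  congr 2
  ring

theorem integral_shift_cpow (h : 0 < c + (y₀ + d)) {s : ℂ} (hs : 1 < s.re) :
    ∫ y in Set.Ici y₀, ((c + (y + d) : ℝ) : ℂ) ^ (-s) =
      ((c + (y₀ + d) : ℝ) : ℂ) ^ (1 - s) / (s - 1) := by
  have hpre : (fun y : ℝ => y + (c + d)) ⁻¹' Set.Ioi (c + (y₀ + d)) = Set.Ioi y₀ := by
    ext y; simp only [Set.mem_preimage, Set.mem_Ioi]; constructor <;> intro h <;> linarith
  have := (measurePreserving_add_right volume (c + d)).setIntegral_preimage_emb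
    (measurableEmbedding_addRight (c + d)) (fun y : ℝ => (y : ℂ) ^ (-s)) (Set.Ioi (c + (y₀ + d)))
  rw [integral_Ioi_cpow_of_lt (by simpa using hs) h, hpre] at this
  rw [integral_Ici_eq_integral_Ioi]
  have he (y : ℝ) : c + (y + d) = y + (c + d) := by ring
  simp_rw [he y₀] at this
  simp_rw [he]
  have hs1 : -s + 1 = 1 - s := by ring
  rw [this, hs1, ← neg_sub s 1, neg_div_neg_eq]

theorem integral_norm_shift_cpow (h : 0 < c + (y₀ + d)) {s : ℂ} (hs : 1 < s.re) :
    ∫ y in Set.Ici y₀, ‖((c + (y + d) : ℝ) : ℂ) ^ (-s)‖ =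
      ‖((c + (y₀ + d) : ℝ) : ℂ) ^ (1 - s)‖ / (s.re - 1) := by
  -- The norm of the power is itself a power with exponent -Re s, so the previous evaluation applies
  -- with Re s in place of s.
  have hnorm : ∀ y ∈ Set.Ici y₀, ‖((c + (y + d) : ℝ) : ℂ) ^ (-s)‖ =
      (((c + (y + d) : ℝ) : ℂ) ^ (-(s.re : ℂ))).re := by
    intro y hy
    have hy' : 0 < c + (y + d) := by linarith [Set.mem_Ici.1 hy]
    rw [Complex.norm_cpow_eq_rpow_re_of_pos hy', ← Complex.ofReal_neg,
      ← Complex.ofReal_cpow hy'.le, Complex.ofReal_re, Complex.neg_re]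
  have hs' : 1 < (s.re : ℂ).re := by simpa using hs
  rw [setIntegral_congr_fun measurableSet_Ici hnorm]
  have h1 := integral_re (𝕜 := ℂ) (integrableOn_shift_cpow h hs')
  have h2 := integral_shift_cpow h hs'
  simp only [RCLike.re_to_complex] at h1
  rw [h1, h2, Complex.norm_cpow_eq_rpow_re_of_pos h, ← Complex.ofReal_one, ← Complex.ofReal_sub,
    ← Complex.ofReal_cpow h.le, ← Complex.ofReal_sub, ← Complex.ofReal_div, Complex.ofReal_re]
  simp

end OneVariable

/-! ### Splitting off the last variable by Fubini. -/

section Peel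

variable {α a : Fin (n + 1) → ℝ} {s : Fin (n + 1) → ℂ}

/-- The integrand in the first `n` variables, times the `K`-th remainder of the binomial expansion
of what the integration over the last variable produces. -/
noncomputable def remainderIntegrand (K : ℕ) (α a : Fin (n + 1) → ℝ) (s : Fin (n + 1) → ℂ)
    (x : Fin n → ℝ) : ℂ :=
  integrand (n := n) (Fin.init a) (Fin.init s) x *
    remainder K (1 - s (Fin.last n)) (∑ i, (x i + a i.castSucc))
      (α (Fin.last n) + a (Fin.last n))

theorem measurable_remainderIntegrand (K : ℕ) :
    Measurable (remainderIntegrand K α a s) := by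
  unfold remainderIntegrand remainder
  have := measurable_integrand (n := n) (Fin.init a) (Fin.init s)
  fun_prop

theorem last_sum_pos (h : PosSums α a) {x : Fin n → ℝ}
    (hx : x ∈ Set.Ici (Fin.init α : Fin n → ℝ)) :
    0 < ∑ i, (x i + a i.castSucc) + (α (Fin.last n) + a (Fin.last n)) := by
  have := h.sum_pos
  rw [Fin.sum_univ_castSucc] at this
  refine this.trans_le ?_
  gcongr with i
  exact hx i

theorem preimage_snoc_Ici (α : Fin (n + 1) → ℝ) :
    (MeasurableEquiv.piFinSuccAbove (fun _ => ℝ) (Fin.last n)).symm ⁻¹' Set.Ici α =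
      Set.Ici (α (Fin.last n)) ×ˢ Set.Ici (Fin.init α : Fin n → ℝ) := by
  ext ⟨y, x⟩
  simp only [Set.mem_preimage, Set.mem_Ici, Set.mem_prod, Pi.le_def, Fin.forall_fin_succ',
    MeasurableEquiv.piFinSuccAbove_symm_apply, Fin.insertNthEquiv, Equiv.coe_fn_mk,
    Fin.insertNth_last', Fin.snoc_castSucc, Fin.snoc_last, Fin.init]
  exact and_comm

theorem measurePreserving_snoc :
    MeasurePreserving (MeasurableEquiv.piFinSuccAbove (fun _ => ℝ) (Fin.last n)).symm :=
  (volume_preserving_piFinSuccAbove (fun _ : Fin (n + 1) => ℝ) (Fin.last n)).symm _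

theorem integrand_comp_snoc (p : ℝ × (Fin n → ℝ)) :
    integrand a s ((MeasurableEquiv.piFinSuccAbove (fun _ => ℝ) (Fin.last n)).symm p) =
      integrand (n := n) (Fin.init a) (Fin.init s) p.2 *
        ((∑ i, (p.2 i + a i.castSucc) + (p.1 + a (Fin.last n)) : ℝ) : ℂ) ^
          (-s (Fin.last n)) := by
  rw [← integrand_snoc]
  simp only [MeasurableEquiv.piFinSuccAbove_symm_apply, Fin.insertNthEquiv, Equiv.coe_fn_mk,
    Fin.insertNth_last']

/-- Tonelli: integrating the norm over the last variable gives the norm of the order-zero remainder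
integrand divided by Re s_n - 1. -/
theorem integrable_prod_of_remainderIntegrand (hpos : PosSums α a)
    (hs : 1 < (s (Fin.last n)).re)
    (h : IntegrableOn (remainderIntegrand 0 α a s) (Set.Ici (Fin.init α : Fin n → ℝ))) :
    Integrable (fun p : ℝ × (Fin n → ℝ) => integrand (n := n) (Fin.init a) (Fin.init s) p.2 *
        ((∑ i, (p.2 i + a i.castSucc) + (p.1 + a (Fin.last n)) : ℝ) : ℂ) ^ (-s (Fin.last n)))
      ((volume.restrict (Set.Ici (α (Fin.last n)))).prod
        (volume.restrict (Set.Ici (Fin.init α : Fin n → ℝ)))) := by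
  have hmeas := measurable_integrand (n := n) (Fin.init a) (Fin.init s)
  rw [integrable_prod_iff' (by fun_prop)]
  constructor
  · filter_upwards [ae_restrict_mem measurableSet_Ici] with x hx
    exact (integrableOn_shift_cpow (last_sum_pos hpos hx) hs).const_mul _
  · refine ((h.norm.div_const ((s (Fin.last n)).re - 1))).congr ?_
    filter_upwards [ae_restrict_mem measurableSet_Ici] with x hx
    simp only [norm_mul, integral_const_mul]
    rw [integral_norm_shift_cpow (last_sum_pos hpos hx) hs, remainderIntegrand, remainder_zero,
      norm_mul, mul_div_assoc]

theorem integrableOn_integrand_of_remainderIntegrand (hpos : PosSums α a)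
    (hs : 1 < (s (Fin.last n)).re)
    (h : IntegrableOn (remainderIntegrand 0 α a s) (Set.Ici (Fin.init α : Fin n → ℝ))) :
    IntegrableOn (integrand a s) (Set.Ici α) := by
  rw [← measurePreserving_snoc.integrableOn_comp_preimage (MeasurableEquiv.measurableEmbedding _),
    preimage_snoc_Ici, IntegrableOn, Measure.volume_eq_prod, ← Measure.prod_restrict]
  refine (integrable_prod_of_remainderIntegrand hpos hs h).congr (Eventually.of_forall fun p => ?_)
  exact (integrand_comp_snoc p).symm

theorem Y_eq_integral_remainderIntegrand (hpos : PosSums α a)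
    (hs : 1 < (s (Fin.last n)).re)
    (h : IntegrableOn (remainderIntegrand 0 α a s) (Set.Ici (Fin.init α : Fin n → ℝ))) :
    Y α a s = (∫ x in Set.Ici (Fin.init α : Fin n → ℝ), remainderIntegrand 0 α a s x) /
      (s (Fin.last n) - 1) := by
  rw [Y, ← measurePreserving_snoc.setIntegral_preimage_emb (MeasurableEquiv.measurableEmbedding _),
    preimage_snoc_Ici, Measure.volume_eq_prod, ← Measure.prod_restrict]
  simp_rw [integrand_comp_snoc]
  rw [integral_prod_symm _ (integrable_prod_of_remainderIntegrand hpos hs h), ← integral_div]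
  refine setIntegral_congr_fun measurableSet_Ici fun x hx => ?_
  simp only [integral_const_mul]
  rw [integral_shift_cpow (last_sum_pos hpos hx) hs, remainderIntegrand, remainder_zero,
    mul_div_assoc]

end Peel

/-! ### Fused exponents and the region of convergence. -/

theorem isOpen_convergenceRegion (n : ℕ) : IsOpen (convergenceRegion n) := by
  have : convergenceRegion n =
      ⋂ j : Fin n, {s | (n : ℝ) - (j : ℕ) < (∑ i ∈ Finset.Ici j, s i).re} := by
    ext; simp [convergenceRegion]
  rw [this]
  refine isOpen_iInter_of_finite fun j => isOpen_lt continuous_const ?_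
  fun_prop

/-- Removes the last exponent and adds it, shifted by `K - 1`, to the one before. -/
noncomputable def fuse (K : ℕ) (s : Fin (m + 2) → ℂ) : Fin (m + 1) → ℂ :=
  (Fin.init s : Fin (m + 1) → ℂ) + Pi.single (Fin.last m) (s (Fin.last (m + 1)) - 1 + K)

/-- The last index belongs to every tail, so all tail sums move together by K - 1. Both the
convergence conditions and the polar conditions are therefore easy to track under `fuse`. -/
theorem sum_Ici_fuse (K : ℕ) (s : Fin (m + 2) → ℂ) (j : Fin (m + 1)) :
    ∑ i ∈ Finset.Ici j, fuse K s i = ∑ i ∈ Finset.Ici j.castSucc, s i - 1 + K := by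
  have : ∑ i ∈ Finset.Ici j, (Pi.single (Fin.last m) (s (Fin.last (m + 1)) - 1 + K) :
      Fin (m + 1) → ℂ) i = s (Fin.last (m + 1)) - 1 + K := by
    simp [Pi.single_apply, Fin.le_last]
  simp only [fuse, Pi.add_apply, Finset.sum_add_distrib, this, sum_Ici_castSucc, Fin.init]
  ring

theorem differentiable_fuse (K : ℕ) : Differentiable ℂ (fuse K : (Fin (m + 2) → ℂ) → _) := by
  unfold fuse
  rw [differentiable_pi]
  intro i
  simp only [Pi.add_apply, Fin.init, Pi.single_apply]
  split_ifs <;> fun_prop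

theorem fuse_mem_convergenceRegion {K : ℕ} {s : Fin (m + 2) → ℂ} :
    fuse K s ∈ convergenceRegion (m + 1) ↔ ∀ j : Fin (m + 1),
      (m + 2 : ℝ) - (j : ℕ) - K < (∑ i ∈ Finset.Ici j.castSucc, s i).re := by
  refine forall_congr' fun j => ?_
  rw [sum_Ici_fuse]
  simp only [Complex.add_re, Complex.sub_re, Complex.one_re, Complex.natCast_re]
  push_cast
  constructor <;> intro h <;> linarith

theorem fuse_mem_convergenceRegion_mono {K K' : ℕ} (h : K ≤ K') {s : Fin (m + 2) → ℂ}
    (hs : fuse K s ∈ convergenceRegion (m + 1)) : fuse K' s ∈ convergenceRegion (m + 1) := by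
  rw [fuse_mem_convergenceRegion] at *
  intro j
  have : (K : ℝ) ≤ K' := by exact_mod_cast h
  linarith [hs j]

theorem exists_fuse_mem_convergenceRegion (s : Fin (m + 2) → ℂ) :
    ∃ K, fuse K s ∈ convergenceRegion (m + 1) := by
  have (j : Fin (m + 1)) : ∀ᶠ K : ℕ in atTop,
      (m + 2 : ℝ) - (j : ℕ) - K < (∑ i ∈ Finset.Ici j.castSucc, s i).re := by
    filter_upwards [tendsto_natCast_atTop_atTop.eventually_gt_atTop
      ((m + 2 : ℝ) - (j : ℕ) - (∑ i ∈ Finset.Ici j.castSucc, s i).re)] with K hK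
    linarith
  obtain ⟨K, hK⟩ := (eventually_all.2 this).exists
  exact ⟨K, fuse_mem_convergenceRegion.2 hK⟩

theorem fuse_zero_mem_convergenceRegion {s : Fin (m + 2) → ℂ}
    (hs : s ∈ convergenceRegion (m + 2)) : fuse 0 s ∈ convergenceRegion (m + 1) := by
  rw [fuse_mem_convergenceRegion]
  intro j
  simpa using hs j.castSucc

theorem one_lt_re_last {s : Fin (n + 1) → ℂ} (hs : s ∈ convergenceRegion (n + 1)) :
    1 < (s (Fin.last n)).re := by
  simpa [sum_Ici_last] using hs (Fin.last n)

theorem integrand_fuse {a x : Fin (m + 1) → ℝ} (hx : PosSums x a) (K : ℕ)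
    (s : Fin (m + 2) → ℂ) :
    integrand a (fuse K s) x = integrand (n := m + 1) a (Fin.init s) x *
      ((∑ i, (x i + a i) : ℝ) : ℂ) ^ (1 - s (Fin.last (m + 1)) - K) := by
  rw [fuse, integrand_add_single hx]
  congr 2
  ring

/-! ### Absolute convergence and domination. -/

section Bounds

variable {α a : Fin (m + 2) → ℝ}

theorem exists_norm_remainderIntegrand_le (hpos : PosSums α a) (K : ℕ) (ρ : ℝ) :
    ∃ C, 0 ≤ C ∧ ∀ s : Fin (m + 2) → ℂ, ‖s‖ ≤ ρ →
      ∀ x ∈ Set.Ici (Fin.init α : Fin (m + 1) → ℝ), ‖remainderIntegrand K α a s x‖ ≤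
        C * ‖integrand (n := m + 1) (Fin.init a) (fuse K s) x‖ := by
  have hB := hpos.init.sum_pos
  have hBb : 0 < ∑ i, ((Fin.init α : Fin (m + 1) → ℝ) i + (Fin.init a : Fin (m + 1) → ℝ) i) +
      (α (Fin.last (m + 1)) + a (Fin.last (m + 1))) := by
    have := hpos.sum_pos
    rwa [Fin.sum_univ_castSucc] at this
  obtain ⟨C, hC, h⟩ := exists_norm_remainder_le hB hBb K (1 + ρ)
  refine ⟨C, hC, fun s hs x hx => ?_⟩
  have hxp := hpos.init.of_mem_Ici hx
  have hle : ∑ i, ((Fin.init α : Fin (m + 1) → ℝ) i + (Fin.init a : Fin (m + 1) → ℝ) i) ≤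
      ∑ i, (x i + a i.castSucc) := by
    gcongr with i
    · exact hx i
    · exact le_rfl
  have hw : ‖1 - s (Fin.last (m + 1))‖ ≤ 1 + ρ :=
    (norm_sub_le _ _).trans (by simpa using (norm_le_pi_norm s _).trans hs)
  have h1 := h _ hw _ hle
  have h2 : 0 < ∑ i, (x i + (Fin.init a : Fin (m + 1) → ℝ) i) := hxp.sum_pos
  rw [integrand_fuse hxp, remainderIntegrand, norm_mul, norm_mul,
    Complex.norm_cpow_eq_rpow_re_of_pos h2, mul_left_comm]
  refine mul_le_mul_of_nonneg_left ?_ (norm_nonneg _)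
  simpa [Fin.init] using h1

theorem integrableOn_remainderIntegrand_of_fuse (hpos : PosSums α a) {K : ℕ}
    {s : Fin (m + 2) → ℂ}
    (h : IntegrableOn (integrand (n := m + 1) (Fin.init a) (fuse K s)) (Set.Ici (Fin.init α))) :
    IntegrableOn (remainderIntegrand K α a s) (Set.Ici (Fin.init α : Fin (m + 1) → ℝ)) := by
  obtain ⟨C, -, hb⟩ := exists_norm_remainderIntegrand_le hpos K ‖s‖
  refine (h.norm.const_mul C).mono' (measurable_remainderIntegrand K).aestronglyMeasurable ?_
  filter_upwards [ae_restrict_mem measurableSet_Ici] with x hx using hb s le_rfl x hx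

end Bounds

theorem integrableOn_remainderIntegrand_fin_zero (K : ℕ) (α a : Fin 1 → ℝ) (s : Fin 1 → ℂ) :
    IntegrableOn (remainderIntegrand K α a s) (Set.Ici (Fin.init α : Fin 0 → ℝ)) := by
  have : remainderIntegrand K α a s = fun _ => remainderIntegrand K α a s 0 := by
    funext x
    rw [Subsingleton.elim x 0]
  rw [this]
  refine integrableOn_const (measure_lt_top_of_subset (Set.subset_univ _) ?_).ne
  simp [volume_pi]

/-- Induction on n: after integration over the last variable, the integrand is bounded by a constant
times the lower-dimensional integrand at `fuse 0 s`, which is the remainder bound of order zero. -/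
theorem integrableOn_integrand : ∀ {n : ℕ} {α a : Fin n → ℝ}, PosSums α a → ∀ {s : Fin n → ℂ},
    s ∈ convergenceRegion n → IntegrableOn (integrand a s) (Set.Ici α)
  | 0, α, a, _, s, _ => by
    have : integrand a s = fun _ => 1 := by funext x; simp [integrand]
    rw [this]
    refine integrableOn_const (measure_lt_top_of_subset (Set.subset_univ _) ?_).ne
    simp [volume_pi]
  | 1, _, _, hpos, _, hs =>
    integrableOn_integrand_of_remainderIntegrand hpos (one_lt_re_last hs)
      (integrableOn_remainderIntegrand_fin_zero _ _ _ _)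
  | _ + 2, _, _, hpos, _, hs =>
    integrableOn_integrand_of_remainderIntegrand hpos (one_lt_re_last hs)
      (integrableOn_remainderIntegrand_of_fuse hpos
        (integrableOn_integrand hpos.init (fuse_zero_mem_convergenceRegion hs)))

theorem integrableOn_remainderIntegrand {α a : Fin (m + 2) → ℝ} (hpos : PosSums α a) {K : ℕ}
    {s : Fin (m + 2) → ℂ} (hs : fuse K s ∈ convergenceRegion (m + 1)) :
    IntegrableOn (remainderIntegrand K α a s) (Set.Ici (Fin.init α : Fin (m + 1) → ℝ)) :=
  integrableOn_remainderIntegrand_of_fuse hpos (integrableOn_integrand hpos.init hs)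

theorem rpow_neg_le_mul_rpow {B c σ σ₀ ε : ℝ} (hB : 0 < B) (hc : B ≤ c) (hσ : |σ - σ₀| ≤ ε) :
    c ^ (-σ) ≤ (min B 1) ^ (-(2 * ε)) * c ^ (-(σ₀ - ε)) := by
  have hc0 := hB.trans_le hc
  have hβ : 0 < min B 1 := lt_min hB one_pos
  obtain ⟨h1, h2⟩ := abs_le.1 hσ
  -- The first exponent lies in [-2ε, 0], so its power of c is at most the same power of min B 1 ≤
  -- 1, hence at most (min B 1)^(-2ε).
  have he : -σ = -(σ - σ₀ + ε) + -(σ₀ - ε) := by ring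
  rw [he, Real.rpow_add hc0]
  refine mul_le_mul_of_nonneg_right ?_ (by positivity)
  exact (Real.rpow_le_rpow_of_nonpos hβ ((min_le_left _ _).trans hc) (by linarith)).trans
    (Real.rpow_le_rpow_of_exponent_ge hβ (min_le_right _ _) (by linarith))

/-- Lowering every exponent of s₀ by a small ε stays inside the open region of convergence, and the
integrand at that point dominates, up to a constant, all integrands with exponents within ε of s₀.
-/
theorem exists_dominating {α a : Fin n → ℝ} (hpos : PosSums α a) {s₀ : Fin n → ℂ}
    (hs₀ : s₀ ∈ convergenceRegion n) : ∃ r > 0, ∃ g : (Fin n → ℝ) → ℝ,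
      IntegrableOn g (Set.Ici α) ∧
      ∀ s ∈ Metric.ball s₀ r, ∀ x ∈ Set.Ici α, ‖integrand a s x‖ ≤ g x := by
  have hcont : ContinuousAt (fun ε : ℝ => s₀ - fun _ => (ε : ℂ)) 0 := by fun_prop
  have hev : ∀ᶠ ε : ℝ in 𝓝[>] 0, (s₀ - fun _ => (ε : ℂ)) ∈ convergenceRegion n := by
    refine nhdsWithin_le_nhds (hcont.eventually_mem ((isOpen_convergenceRegion n).mem_nhds ?_))
    convert hs₀ using 1
    ext i
    simp
  obtain ⟨ε, hε, hε0⟩ := (hev.and self_mem_nhdsWithin).exists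
  refine ⟨ε, hε0, fun x => (∏ i, (min (∑ j ∈ Finset.Iic i, (α j + a j)) 1) ^ (-(2 * ε))) *
    ‖integrand a (s₀ - fun _ => (ε : ℂ)) x‖, (integrableOn_integrand hpos hε).norm.const_mul _,
    fun s hs x hx => ?_⟩
  have hxp := hpos.of_mem_Ici hx
  beta_reduce
  rw [norm_integrand _ hxp, norm_integrand _ hxp, ← Finset.prod_mul_distrib]
  refine Finset.prod_le_prod (fun i _ => Real.rpow_nonneg (hxp i).le _) fun i _ => ?_
  have hd : |(s i).re - (s₀ i).re| ≤ ε := by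
    have := (Complex.abs_re_le_norm ((s - s₀) i)).trans (norm_le_pi_norm (s - s₀) i)
    simpa using this.trans (mem_ball_iff_norm.1 hs).le
  simpa using rpow_neg_le_mul_rpow (hpos i)
    (Finset.sum_le_sum fun j _ => add_le_add_left (Set.mem_Ici.1 hx j) _) hd

theorem differentiable_remainder (K : ℕ) {c b : ℝ} (hc : 0 < c) (hcb : 0 < c + b) :
    Differentiable ℂ fun w => remainder K w c b := by
  have hc' : (c : ℂ) ≠ 0 := by exact_mod_cast hc.ne'
  have hcb' : ((c + b : ℝ) : ℂ) ≠ 0 := by exact_mod_cast hcb.ne'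
  unfold remainder
  refine Differentiable.sub (Differentiable.const_cpow differentiable_id (Or.inl hcb')) ?_
  refine Differentiable.fun_sum fun k _ => ?_
  exact ((differentiable_binom k).mul_const _).mul
    (Differentiable.const_cpow (by fun_prop) (Or.inl hc'))

theorem differentiableAt_integral_remainderIntegrand {α a : Fin (m + 2) → ℝ}
    (hpos : PosSums α a) {K : ℕ} {s₀ : Fin (m + 2) → ℂ}
    (hs₀ : fuse K s₀ ∈ convergenceRegion (m + 1)) :
    DifferentiableAt ℂ (fun s => ∫ x in Set.Ici (Fin.init α : Fin (m + 1) → ℝ),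
      remainderIntegrand K α a s x) s₀ := by
  obtain ⟨r, hr, g, hg, hdom⟩ := exists_dominating hpos.init hs₀
  obtain ⟨C, hC, hb⟩ := exists_norm_remainderIntegrand_le hpos K (‖s₀‖ + 1)
  obtain ⟨δ, hδ, hball⟩ := Metric.mem_nhds_iff.1
    ((differentiable_fuse K).continuous.continuousAt.preimage_mem_nhds (Metric.ball_mem_nhds _ hr))
  refine differentiableAt_integral_of_dominated (r := min δ 1) (by positivity)
    (g := fun x => C * g x) (fun s => (measurable_remainderIntegrand K).aestronglyMeasurable)
    ?_ ?_ (hg.const_mul C)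
  · filter_upwards [ae_restrict_mem measurableSet_Ici] with x hx
    have hxp := hpos.init.of_mem_Ici hx
    have hinit : Differentiable ℂ fun s : Fin (m + 2) → ℂ => (Fin.init s : Fin (m + 1) → ℂ) := by
      rw [differentiable_pi]
      intro i
      simp only [Fin.init]
      fun_prop
    exact ((differentiable_integrand hxp).comp hinit).mul
      ((differentiable_remainder K hxp.sum_pos (last_sum_pos hpos hx)).comp (by fun_prop))
  · filter_upwards [ae_restrict_mem measurableSet_Ici] with x hx s hs
    have hs1 : s ∈ Metric.ball s₀ δ := Metric.ball_subset_ball (min_le_left _ _) hs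
    have hs2 : ‖s‖ ≤ ‖s₀‖ + 1 := by
      have := mem_ball_iff_norm.1 (Metric.ball_subset_ball (min_le_right _ _) hs)
      have := norm_le_norm_add_norm_sub' s s₀
      linarith
    exact (hb s hs2 x hx).trans (mul_le_mul_of_nonneg_left (hdom _ (hball hs1) x hx) hC)

/-! ### The polar divisors. -/

section PolarSet

theorem mem_polarSet {s : Fin n → ℂ} : s ∈ polarSet n ↔ ∃ j : Fin n, ∃ k : Fin n → ℕ,
    (∑ i ∈ Finset.Ici j, s i) - (n : ℂ) + ((j : ℕ) : ℂ) + ∑ i ∈ Finset.Ioi j, (k i : ℂ) = 0 := by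
  simp only [polarSet, Set.mem_ofPred_eq, Finset.prod_eq_zero_iff, Finset.mem_univ, true_and]
  exact exists_comm

theorem sum_mem_range_intCast_of_form_eq_zero {s : Fin n → ℂ} {j : Fin n} {k : Fin n → ℕ}
    (h : (∑ i ∈ Finset.Ici j, s i) - (n : ℂ) + ((j : ℕ) : ℂ) +
      ∑ i ∈ Finset.Ioi j, (k i : ℂ) = 0) :
    ∑ i ∈ Finset.Ici j, s i = ((n - (j : ℕ) - ∑ i ∈ Finset.Ioi j, (k i : ℤ) : ℤ) : ℂ) := by
  push_cast
  linear_combination h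

theorem isClosed_image_intCast (S : Set ℤ) : IsClosed (((↑) : ℤ → ℂ) '' S) :=
  Complex.isClosedEmbedding_intCast.isClosedMap _ (isClosed_discrete S)

/-- Each divisor prescribes an integer value of a tail sum, and every set of integers is closed in
ℂ; so the infinite union over k is harmless. -/
theorem isClosed_polarSet (n : ℕ) : IsClosed (polarSet n) := by
  have : polarSet n = ⋃ j : Fin n, (fun s : Fin n → ℂ => ∑ i ∈ Finset.Ici j, s i) ⁻¹'
      (((↑) : ℤ → ℂ) '' Set.range fun k : Fin n → ℕ =>
        (n - (j : ℕ) - ∑ i ∈ Finset.Ioi j, (k i : ℤ) : ℤ)) := by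
    ext s
    simp only [mem_polarSet, Set.mem_iUnion, Set.mem_preimage, Set.mem_image,
      Set.exists_range_iff]
    refine exists_congr fun j => exists_congr fun k => ⟨fun h =>
      (sum_mem_range_intCast_of_form_eq_zero h).symm, fun h => ?_⟩
    rw [← h]
    push_cast
    ring
  rw [this]
  exact isClosed_iUnion_of_finite fun j =>
    (isClosed_image_intCast _).preimage (by fun_prop)

theorem disjoint_convergenceRegion_polarSet (n : ℕ) :
    Disjoint (convergenceRegion n) (polarSet n) := by
  rw [Set.disjoint_left]
  intro s hs hp
  obtain ⟨j, k, h⟩ := mem_polarSet.1 hp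
  have h1 := hs j
  rw [sum_mem_range_intCast_of_form_eq_zero h, Complex.intCast_re] at h1
  push_cast at h1
  have : (0 : ℝ) ≤ ∑ i ∈ Finset.Ioi j, (k i : ℝ) := by positivity
  linarith

/-- A divisor in m + 1 variables with data k pulls back to the divisor in m + 2 variables with data
(k, K). -/
theorem fuse_notMem_polarSet {s : Fin (m + 2) → ℂ} (hs : s ∉ polarSet (m + 2)) (K : ℕ) :
    fuse K s ∉ polarSet (m + 1) := by
  contrapose! hs
  obtain ⟨j, k, h⟩ := mem_polarSet.1 hs
  refine mem_polarSet.2 ⟨j.castSucc, Fin.snoc k K, ?_⟩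
  rw [sum_Ici_fuse] at h
  simp only [sum_Ioi_castSucc, Fin.snoc_castSucc, Fin.snoc_last, Fin.val_castSucc]
  rw [← h]
  push_cast
  ring

theorem last_ne_one {s : Fin (n + 1) → ℂ} (hs : s ∉ polarSet (n + 1)) : s (Fin.last n) ≠ 1 := by
  contrapose! hs
  refine mem_polarSet.2 ⟨Fin.last n, 0, ?_⟩
  simp [sum_Ici_last, hs]

end PolarSet

/-! ### Uniqueness of the continuation. -/

section Uniqueness

theorem sum_Ici_add_single_last (s : Fin (n + 1) → ℂ) (z : ℂ) (j : Fin (n + 1)) :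
    ∑ i ∈ Finset.Ici j, (s + Pi.single (Fin.last n) z : Fin (n + 1) → ℂ) i =
      ∑ i ∈ Finset.Ici j, s i + z := by
  simp [Finset.sum_add_distrib, Pi.single_apply, Fin.le_last]

/-- Two continuations agree off the possible polar divisors: restrict to a line parallel to the
last axis, where the polar divisors leave a connected set. -/
theorem IsContinuation.eqOn {α a : Fin (n + 1) → ℝ} {F G : (Fin (n + 1) → ℂ) → ℂ}
    (hF : IsContinuation α a F) (hG : IsContinuation α a G) :
    Set.EqOn F G (polarSet (n + 1))ᶜ := by
  intro s hs
  let line : ℂ → Fin (n + 1) → ℂ := fun z => s + Pi.single (Fin.last n) z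
  have hline : Differentiable ℂ line := by
    rw [differentiable_pi]
    intro i
    simp only [line, Pi.add_apply, Pi.single_apply]
    split_ifs <;> fun_prop
  set U : Set ℂ := line ⁻¹' (polarSet (n + 1))ᶜ with hU
  have hUo : IsOpen U := (isClosed_polarSet _).isOpen_compl.preimage hline.continuous
  -- Along the line all tail sums increase by z, so polar points correspond to integer values and
  -- are countable; the complement of a countable set in ℂ is connected.
  have hcount : (line ⁻¹' polarSet (n + 1)).Countable := by
    have hsub : line ⁻¹' polarSet (n + 1) ⊆ ⋃ j : Fin (n + 1),
        Set.range fun k : ℤ => (k : ℂ) - ∑ i ∈ Finset.Ici j, s i := by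
      intro z hz
      obtain ⟨j, k, h⟩ := mem_polarSet.1 hz
      have h1 := sum_mem_range_intCast_of_form_eq_zero h
      rw [sum_Ici_add_single_last] at h1
      exact Set.mem_iUnion.2 ⟨j, _, (eq_sub_of_add_eq' h1).symm⟩
    exact (Set.countable_iUnion fun j => Set.countable_range _).mono hsub
  have hUc : IsPreconnected U :=
    (hcount.isPathConnected_compl_of_one_lt_rank (by simp)).isConnected.isPreconnected
  have hmem : ∀ᶠ x : ℝ in atTop, line x ∈ convergenceRegion (n + 1) := by
    refine (eventually_all (ι := Fin (n + 1))).2 fun j => ?_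
    filter_upwards [eventually_gt_atTop
      (((n + 1 : ℕ) : ℝ) - (j : ℕ) - (∑ i ∈ Finset.Ici j, s i).re)] with x hx
    rw [sum_Ici_add_single_last, Complex.add_re, Complex.ofReal_re]
    linarith
  obtain ⟨x, hx⟩ := hmem.exists
  have hana {H : (Fin (n + 1) → ℂ) → ℂ} (hH : IsContinuation α a H) :
      AnalyticOnNhd ℂ (H ∘ line) U :=
    (hH.holomorphic.comp hline.differentiableOn fun _ h => h).analyticOnNhd hUo
  have h0 : line 0 = s := by simp [line]
  have := (hana hF).eqOn_of_preconnected_of_eventuallyEq (hana hG) hUc (z₀ := (x : ℂ))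
    ((disjoint_convergenceRegion_polarSet _).subset_compl_right hx) ?_
    (show (0 : ℂ) ∈ U by simpa [hU, h0] using hs)
  · simpa [h0] using this
  · filter_upwards [((isOpen_convergenceRegion _).preimage hline.continuous).mem_nhds hx]
      with z hz
    simp only [Function.comp_apply]
    rw [hF.eq_integral _ hz, hG.eq_integral _ hz]

end Uniqueness

/-! ### Existence of the continuation, by induction on n. -/

section Construction

/-- The continuation in one variable. -/
theorem isContinuation_one {α a : Fin 1 → ℝ} (hpos : PosSums α a) :
    IsContinuation α a fun s => ((α 0 + a 0 : ℝ) : ℂ) ^ (1 - s 0) / (s 0 - 1) where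
  holomorphic := by
    have h0 : ((α 0 + a 0 : ℝ) : ℂ) ≠ 0 := by
      have := hpos.sum_pos
      rw [Fin.sum_univ_one] at this
      exact_mod_cast this.ne'
    have h1 : DifferentiableOn ℂ (fun s : Fin 1 → ℂ => ((α 0 + a 0 : ℝ) : ℂ) ^ (1 - s 0))
        (polarSet 1)ᶜ :=
      (Differentiable.const_cpow (by fun_prop) (Or.inl h0)).differentiableOn
    simp only [div_eq_mul_inv]
    refine h1.mul (DifferentiableOn.fun_inv (by fun_prop) fun s hs => ?_)
    exact sub_ne_zero.2 (last_ne_one hs)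
  eq_integral s hs := by
    rw [Y_eq_integral_remainderIntegrand hpos (one_lt_re_last hs)
      (integrableOn_remainderIntegrand_fin_zero _ _ _ _)]
    have hset : Set.Ici (Fin.init α : Fin 0 → ℝ) = Set.univ := by
      ext x; simp [Subsingleton.elim x (Fin.init α)]
    have hfun : remainderIntegrand 0 α a s =
        fun _ => ((α 0 + a 0 : ℝ) : ℂ) ^ (1 - s 0) := by
      funext x
      simp [remainderIntegrand, remainder_zero, integrand]
    rw [hset, hfun]
    simp [volume_pi, measureReal_def]

variable {α a : Fin (m + 2) → ℝ} {F : (Fin (m + 1) → ℂ) → ℂ}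

/-- The continuation in one more variable, on the set where `K` terms of the expansion suffice. -/
noncomputable def partialContinuation (α a : Fin (m + 2) → ℝ) (F : (Fin (m + 1) → ℂ) → ℂ)
    (K : ℕ) (s : Fin (m + 2) → ℂ) : ℂ :=
  (∑ k ∈ Finset.range K, binom (1 - s (Fin.last (m + 1))) k *
      ((α (Fin.last (m + 1)) + a (Fin.last (m + 1)) : ℝ) : ℂ) ^ k * F (fuse k s) +
    ∫ x in Set.Ici (Fin.init α : Fin (m + 1) → ℝ), remainderIntegrand K α a s x) /
  (s (Fin.last (m + 1)) - 1)

/-- When the K-th expansion term is integrable, its integral is `Y` at `fuse K s`, where it agrees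
with `F`; the term just moves from the integral into the sum. -/
theorem partialContinuation_succ (hpos : PosSums α a)
    (hF : IsContinuation (n := m + 1) (Fin.init α) (Fin.init a) F) {K : ℕ} {s : Fin (m + 2) → ℂ}
    (hs : fuse K s ∈ convergenceRegion (m + 1)) :
    partialContinuation α a F (K + 1) s = partialContinuation α a F K s := by
  have hint := integrableOn_integrand hpos.init hs
  have hrem := integrableOn_remainderIntegrand hpos
    (fuse_mem_convergenceRegion_mono K.le_succ hs)
  have hsplit : ∀ x ∈ Set.Ici (Fin.init α : Fin (m + 1) → ℝ), remainderIntegrand K α a s x =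
      binom (1 - s (Fin.last (m + 1))) K *
        ((α (Fin.last (m + 1)) + a (Fin.last (m + 1)) : ℝ) : ℂ) ^ K *
        integrand (n := m + 1) (Fin.init a) (fuse K s) x + remainderIntegrand (K + 1) α a s x := by
    intro x hx
    rw [integrand_fuse (hpos.init.of_mem_Ici hx), remainderIntegrand, remainder_succ,
      remainderIntegrand]
    simp only [Fin.init]
    ring
  rw [partialContinuation, partialContinuation, setIntegral_congr_fun measurableSet_Ici hsplit,
    integral_add (hint.const_mul _) hrem, integral_const_mul, Finset.sum_range_succ,
    hF.eq_integral _ hs, Y, add_assoc]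

theorem partialContinuation_eq_of_le (hpos : PosSums α a)
    (hF : IsContinuation (n := m + 1) (Fin.init α) (Fin.init a) F) {K K' : ℕ} (h : K ≤ K')
    {s : Fin (m + 2) → ℂ} (hs : fuse K s ∈ convergenceRegion (m + 1)) :
    partialContinuation α a F K' s = partialContinuation α a F K s := by
  induction K', h using Nat.le_induction with
  | base => rfl
  | succ K' h ih =>
    rw [partialContinuation_succ hpos hF (fuse_mem_convergenceRegion_mono h hs), ih]

/-- The continuation in one more variable. -/
noncomputable def extendContinuation (α a : Fin (m + 2) → ℝ) (F : (Fin (m + 1) → ℂ) → ℂ)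
    (s : Fin (m + 2) → ℂ) : ℂ :=
  partialContinuation α a F (exists_fuse_mem_convergenceRegion s).choose s

/-- The chosen order and K are both compared with their maximum, so the choice is immaterial. -/
theorem extendContinuation_eq (hpos : PosSums α a)
    (hF : IsContinuation (n := m + 1) (Fin.init α) (Fin.init a) F) {K : ℕ}
    {s : Fin (m + 2) → ℂ} (hs : fuse K s ∈ convergenceRegion (m + 1)) :
    extendContinuation α a F s = partialContinuation α a F K s := by
  have hch := (exists_fuse_mem_convergenceRegion s).choose_spec
  rw [extendContinuation, ← partialContinuation_eq_of_le hpos hF (le_max_left _ K) hch,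
    ← partialContinuation_eq_of_le hpos hF (le_max_right _ K) hs]

theorem isContinuation_extendContinuation (hpos : PosSums α a)
    (hF : IsContinuation (n := m + 1) (Fin.init α) (Fin.init a) F) :
    IsContinuation α a (extendContinuation α a F) where
  holomorphic s hs := by
    obtain ⟨K, hK⟩ := exists_fuse_mem_convergenceRegion s
    -- The condition on K is open in s, so one fixed K serves in a neighbourhood.
    have hev : extendContinuation α a F =ᶠ[𝓝 s] partialContinuation α a F K := by
      filter_upwards [((isOpen_convergenceRegion _).preimage
        (differentiable_fuse K).continuous).mem_nhds hK] with t ht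
      exact extendContinuation_eq hpos hF ht
    refine DifferentiableWithinAt.congr_of_eventuallyEq (f := partialContinuation α a F K) ?_
      (hev.filter_mono nhdsWithin_le_nhds) hev.self_of_nhds
    unfold partialContinuation
    simp only [div_eq_mul_inv]
    refine DifferentiableWithinAt.mul (DifferentiableWithinAt.add ?_
      (differentiableAt_integral_remainderIntegrand hpos hK).differentiableWithinAt)
      (DifferentiableWithinAt.fun_inv (by fun_prop) (sub_ne_zero.2 (last_ne_one hs)))
    refine DifferentiableWithinAt.fun_sum fun k _ => ?_
    have hb : Differentiable ℂ fun s : Fin (m + 2) → ℂ =>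
        binom (1 - s (Fin.last (m + 1))) k :=
      (differentiable_binom k).comp (by fun_prop)
    refine ((hb s).differentiableWithinAt.mul_const _).mul ?_
    exact (hF.holomorphic.comp (differentiable_fuse k).differentiableOn
      fun t ht => fuse_notMem_polarSet ht k) s hs
  eq_integral s hs := by
    have h0 := fuse_zero_mem_convergenceRegion hs
    rw [extendContinuation_eq hpos hF h0, partialContinuation,
      Y_eq_integral_remainderIntegrand hpos (one_lt_re_last hs)
        (integrableOn_remainderIntegrand hpos h0)]
    simp

/-- Here 1 - s_n = N + 1 is a natural number, so the generalised binomial coefficients are ordinary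
ones and the expansion is exact once it has N + 2 terms. The order is raised to at least that, which
kills the integral. -/
theorem extendContinuation_of_last_eq_neg (hpos : PosSums α a)
    (hF : IsContinuation (n := m + 1) (Fin.init α) (Fin.init a) F) {s : Fin (m + 2) → ℂ} {N : ℕ}
    (hs : s (Fin.last (m + 1)) = -(N : ℂ)) :
    extendContinuation α a F s = -(∑ k ∈ Finset.range (N + 2), ((N + 1).choose k : ℂ) *
      ((α (Fin.last (m + 1)) + a (Fin.last (m + 1)) : ℝ) : ℂ) ^ k * F (fuse k s)) /
        ((N + 1 : ℕ) : ℂ) := by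
  obtain ⟨K, hK⟩ := exists_fuse_mem_convergenceRegion s
  have hK' := fuse_mem_convergenceRegion_mono (le_max_left K (N + 2)) hK
  have hw : 1 - s (Fin.last (m + 1)) = ((N + 1 : ℕ) : ℂ) := by rw [hs]; push_cast; ring
  have hden : s (Fin.last (m + 1)) - 1 = -((N + 1 : ℕ) : ℂ) := by rw [hs]; push_cast; ring
  have hle : N + 2 ≤ max K (N + 2) := le_max_right _ _
  rw [extendContinuation_eq hpos hF hK', partialContinuation, hw, hden, div_neg, neg_div]
  have hrem : ∀ x, remainderIntegrand (max K (N + 2)) α a s x = 0 := fun x => by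
    rw [remainderIntegrand, hw, remainder_natCast hle, mul_zero]
  simp_rw [hrem, integral_zero, add_zero, binom_natCast]
  rw [← Finset.sum_subset (Finset.range_subset_range.2 hle)]
  intro k _ hk
  rw [Finset.mem_range, not_lt] at hk
  rw [Nat.choose_eq_zero_of_lt (Nat.lt_of_succ_le hk)]
  simp

theorem exists_isContinuation : ∀ {n : ℕ} {α a : Fin (n + 1) → ℝ}, PosSums α a →
    ∃ F, IsContinuation α a F
  | 0, _, _, hpos => ⟨_, isContinuation_one hpos⟩
  | _ + 1, _, _, hpos =>
    have ⟨_, hF⟩ := exists_isContinuation hpos.init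
    ⟨_, isContinuation_extendContinuation hpos hF⟩

end Construction

/-! ### Calculus of iterated limits. -/

section IteratedLimit

/-- `IterEventually n p P` says that `P (s_1, …, s_n)` holds for `s_1` in a punctured neighbourhood
of `p_1`, then `s_2` in a punctured neighbourhood (depending on `s_1`) of `p_2`, and so on. -/
def IterEventually : (n : ℕ) → (Fin n → ℂ) → ((Fin n → ℂ) → Prop) → Prop
  | 0, p, P => P p
  | n + 1, p, P => ∀ᶠ z in 𝓝[≠] (p 0),
      IterEventually n (Fin.tail p) fun t => P (Fin.cons z t : Fin (n + 1) → ℂ)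

theorem IterEventually.mono : ∀ {n : ℕ} {p : Fin n → ℂ} {P Q : (Fin n → ℂ) → Prop},
    IterEventually n p P → (∀ s, P s → Q s) → IterEventually n p Q
  | 0, _, _, _, hP, h => h _ hP
  | _ + 1, _, _, _, hP, h => by
    filter_upwards [hP] with z h1 using h1.mono fun _ => h _

theorem IterEventually.and : ∀ {n : ℕ} {p : Fin n → ℂ} {P Q : (Fin n → ℂ) → Prop},
    IterEventually n p P → IterEventually n p Q → IterEventually n p fun s => P s ∧ Q s
  | 0, _, _, _, hP, hQ => ⟨hP, hQ⟩
  | _ + 1, _, _, _, hP, hQ => by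
    filter_upwards [hP, hQ] with z h1 h2 using h1.and h2

theorem HasIteratedLimit.congr : ∀ {n : ℕ} {f g : (Fin n → ℂ) → ℂ} {p : Fin n → ℂ} {L : ℂ},
    HasIteratedLimit n f p L → IterEventually n p (fun s => f s = g s) → HasIteratedLimit n g p L
  | 0, _, _, _, _, hf, h => h.symm.trans hf
  | _ + 1, _, _, _, _, ⟨φ, hφ, hlim⟩, h => by
    refine ⟨φ, ?_, hlim⟩
    filter_upwards [hφ, h] with z h1 h2 using h1.congr h2

theorem hasIteratedLimit_const (c : ℂ) : ∀ (n : ℕ) (p : Fin n → ℂ),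
    HasIteratedLimit n (fun _ => c) p c
  | 0, _ => rfl
  | n + 1, _ => ⟨fun _ => c, Eventually.of_forall fun _ => hasIteratedLimit_const c n _,
      tendsto_const_nhds⟩

theorem HasIteratedLimit.add : ∀ {n : ℕ} {f g : (Fin n → ℂ) → ℂ} {p : Fin n → ℂ} {L M : ℂ},
    HasIteratedLimit n f p L → HasIteratedLimit n g p M →
      HasIteratedLimit n (fun s => f s + g s) p (L + M)
  | 0, _, _, _, _, _, hf, hg => by simp only [HasIteratedLimit] at *; rw [hf, hg]
  | _ + 1, _, _, _, _, _, ⟨φ, hφ, hφl⟩, ⟨ψ, hψ, hψl⟩ => by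
    refine ⟨fun z => φ z + ψ z, ?_, hφl.add hψl⟩
    filter_upwards [hφ, hψ] with z h1 h2 using h1.add h2

theorem HasIteratedLimit.const_mul (c : ℂ) : ∀ {n : ℕ} {f : (Fin n → ℂ) → ℂ} {p : Fin n → ℂ}
    {L : ℂ}, HasIteratedLimit n f p L → HasIteratedLimit n (fun s => c * f s) p (c * L)
  | 0, _, _, _, hf => by simp only [HasIteratedLimit] at *; rw [hf]
  | _ + 1, _, _, _, ⟨φ, hφ, hφl⟩ => by
    refine ⟨fun z => c * φ z, ?_, hφl.const_mul c⟩
    filter_upwards [hφ] with z h1 using h1.const_mul c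

theorem HasIteratedLimit.sum {ι : Type*} {n : ℕ} {p : Fin n → ℂ} (S : Finset ι)
    {f : ι → (Fin n → ℂ) → ℂ} {L : ι → ℂ} (h : ∀ i ∈ S, HasIteratedLimit n (f i) p (L i)) :
    HasIteratedLimit n (fun s => ∑ i ∈ S, f i s) p (∑ i ∈ S, L i) := by
  classical
  induction S using Finset.induction_on with
  | empty => simpa using hasIteratedLimit_const 0 n p
  | insert i S hi ih =>
    simp only [Finset.sum_insert hi]
    exact (h i (Finset.mem_insert_self _ _)).add
      (ih fun j hj => h j (Finset.mem_insert_of_mem hj))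

theorem tendsto_add_const_punctured (p q : ℂ) :
    Tendsto (fun z : ℂ => z + q) (𝓝[≠] p) (𝓝[≠] (p + q)) := by
  refine tendsto_nhdsWithin_iff.2 ⟨?_, ?_⟩
  · exact ((continuous_add_const q).tendsto p).mono_left nhdsWithin_le_nhds
  · filter_upwards [self_mem_nhdsWithin] with z hz
    simpa using hz

theorem HasIteratedLimit.comp_add : ∀ {n : ℕ} {f : (Fin n → ℂ) → ℂ} {p q : Fin n → ℂ} {L : ℂ},
    HasIteratedLimit n f (p + q) L → HasIteratedLimit n (fun s => f (s + q)) p L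
  | 0, _, _, _, _, hf => hf
  | n + 1, f, p, q, _, ⟨φ, hφ, hφl⟩ => by
    have ht := tendsto_add_const_punctured (p 0) (q 0)
    refine ⟨fun z => φ (z + q 0), ?_, hφl.comp ht⟩
    filter_upwards [ht.eventually hφ] with z hz
    have hcons (t : Fin n → ℂ) : (Fin.cons z t : Fin (n + 1) → ℂ) + q =
        (Fin.cons (z + q 0) (t + Fin.tail q) : Fin (n + 1) → ℂ) := by
      funext i
      refine Fin.cases ?_ (fun i => ?_) i <;> simp [Fin.tail]
    simp only [hcons]
    exact HasIteratedLimit.comp_add (f := fun t => f (Fin.cons (z + q 0) t))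
      (p := Fin.tail p) (q := Fin.tail q) hz

theorem hasIteratedLimit_one {f : (Fin 1 → ℂ) → ℂ} {p : Fin 1 → ℂ} {L : ℂ}
    (h : Tendsto (fun z => f fun _ => z) (𝓝[≠] (p 0)) (𝓝 L)) : HasIteratedLimit 1 f p L := by
  refine ⟨_, Eventually.of_forall fun z => ?_, h⟩
  simp only [HasIteratedLimit]
  congr 1
  funext i
  rw [Fin.eq_zero (show Fin 1 from i)]
  rfl

/-- The innermost limit of an iterated limit can be taken first. -/
theorem hasIteratedLimit_of_tendsto_snoc : ∀ {n : ℕ} {f : (Fin (n + 1) → ℂ) → ℂ}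
    {g : (Fin n → ℂ) → ℂ} {p : Fin (n + 1) → ℂ} {L : ℂ},
    IterEventually n (Fin.init p) (fun s => Tendsto
      (fun z => f (Fin.snoc s z : Fin (n + 1) → ℂ)) (𝓝[≠] (p (Fin.last n))) (𝓝 (g s))) →
    HasIteratedLimit n g (Fin.init p) L → HasIteratedLimit (n + 1) f p L
  | 0, f, g, p, L, h, hg => by
    refine hasIteratedLimit_one ?_
    simp only [HasIteratedLimit, IterEventually] at h hg
    rw [← hg]
    refine h.congr fun z => ?_
    congr 1
  | n + 1, f, g, p, L, h, ⟨φ, hφ, hφl⟩ => by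
    refine ⟨φ, ?_, hφl⟩
    have h' : ∀ᶠ z in 𝓝[≠] (p 0), _ := h
    have hφ' : ∀ᶠ z in 𝓝[≠] (p 0), _ := hφ
    filter_upwards [h', hφ'] with z h1 h2
    refine hasIteratedLimit_of_tendsto_snoc (g := fun t => g (Fin.cons z t)) ?_ h2
    simp only [Fin.cons_snoc_eq_snoc_cons]
    exact h1

end IteratedLimit

/-! ### Generic points avoid the polar divisors. -/

section Generic

theorem eventually_add_notMem_range_intCast (p w : ℂ) :
    ∀ᶠ z in 𝓝[≠] p, z + w ∉ Set.range ((↑) : ℤ → ℂ) := by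
  -- Integers other than p + w form a closed set missing p + w, hence are avoided near p; the value
  -- p + w itself is avoided because z ≠ p.
  have hcl := isClosed_image_intCast {k : ℤ | (k : ℂ) ≠ p + w}
  have hmem : p + w ∈ (((↑) : ℤ → ℂ) '' {k : ℤ | (k : ℂ) ≠ p + w})ᶜ := by
    rintro ⟨k, hk, hkp⟩
    exact hk hkp
  have hcont : ContinuousAt (fun z : ℂ => z + w) p := by fun_prop
  filter_upwards [nhdsWithin_le_nhds (hcont.eventually_mem (hcl.isOpen_compl.mem_nhds hmem)),
    self_mem_nhdsWithin] with z hz hzp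
  rintro ⟨k, hk⟩
  refine hz ⟨k, fun h => hzp ?_, hk⟩
  exact add_right_cancel (hk.symm.trans h)

theorem iterEventually_add_sum_notMem : ∀ {n : ℕ} (p : Fin n → ℂ) {w : ℂ},
    w ∉ Set.range ((↑) : ℤ → ℂ) →
      IterEventually n p fun s => w + ∑ i, s i ∉ Set.range ((↑) : ℤ → ℂ)
  | 0, p, w, hw => by simpa [IterEventually] using hw
  | n + 1, p, w, _ => by
    filter_upwards [eventually_add_notMem_range_intCast (p 0) w] with z hz
    rw [add_comm] at hz
    simpa only [Fin.sum_univ_succ, Fin.cons_zero, Fin.cons_succ, add_assoc] using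
      iterEventually_add_sum_notMem (Fin.tail p) hz

theorem iterEventually_generic : ∀ {n : ℕ} (p : Fin n → ℂ),
    IterEventually n p fun s => ∀ j, ∑ i ∈ Finset.Ici j, s i ∉ Set.range ((↑) : ℤ → ℂ)
  | 0, p => fun j => j.elim0
  | n + 1, p => by
    filter_upwards [eventually_add_notMem_range_intCast (p 0) 0] with z hz
    rw [add_zero] at hz
    have huniv : (Finset.Ici 0 : Finset (Fin (n + 1))) = Finset.univ := by ext; simp
    simpa only [Fin.forall_fin_succ, huniv, Fin.sum_univ_succ, Fin.sum_Ici_succ, Fin.cons_zero,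
      Fin.cons_succ] using
      (iterEventually_add_sum_notMem (Fin.tail p) hz).and (iterEventually_generic (Fin.tail p))

/-- The last form takes the value -N - 1, which is nonzero, and the other tail sums are non-integers
shifted by an integer. -/
theorem snoc_notMem_polarSet {n : ℕ} {s : Fin n → ℂ}
    (hs : ∀ j, ∑ i ∈ Finset.Ici j, s i ∉ Set.range ((↑) : ℤ → ℂ)) (N : ℕ) :
    (Fin.snoc s (-(N : ℂ)) : Fin (n + 1) → ℂ) ∉ polarSet (n + 1) := by
  intro h
  obtain ⟨j, k, hk⟩ := mem_polarSet.1 h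
  induction j using Fin.lastCases with
  | last =>
    simp only [sum_Ici_last, sum_Ioi_last, Fin.snoc_last, Fin.val_last] at hk
    have h1 : ((N + 1 : ℕ) : ℂ) = 0 := by push_cast at hk ⊢; linear_combination -hk
    exact absurd h1 (by exact_mod_cast N.succ_ne_zero)
  | cast j =>
    have h1 := sum_mem_range_intCast_of_form_eq_zero hk
    simp only [sum_Ici_castSucc, Fin.snoc_castSucc, Fin.snoc_last] at h1
    refine hs j ⟨((n + 1 : ℕ) : ℤ) - ((j.castSucc : Fin (n + 1)) : ℕ) -
        ∑ i ∈ Finset.Ioi j.castSucc, (k i : ℤ) + N, ?_⟩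
    rw [Int.cast_add, ← h1]
    simp

end Generic

/-! ### The iterated limit as a recursion. -/

/-- The value at `-N`, computed by eliminating the last variable. -/
noncomputable def recValue : (n : ℕ) → (Fin (n + 1) → ℝ) → (Fin (n + 1) → ℕ) → ℝ
  | 0, b, N => -(b 0 ^ (N 0 + 1) / (N 0 + 1 : ℕ))
  | n + 1, b, N => -(∑ k ∈ Finset.range (N (Fin.last (n + 1)) + 2),
      ((N (Fin.last (n + 1)) + 1).choose k : ℝ) * b (Fin.last (n + 1)) ^ k *
        recValue n (Fin.init b) (Fin.init N +
          Pi.single (Fin.last n) (N (Fin.last (n + 1)) + 1 - k))) /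
      (N (Fin.last (n + 1)) + 1 : ℕ)

theorem IsContinuation.hasIteratedLimit : ∀ {n : ℕ} {α a : Fin (n + 1) → ℝ}, PosSums α a →
    ∀ {F : (Fin (n + 1) → ℂ) → ℂ}, IsContinuation α a F → ∀ N : Fin (n + 1) → ℕ,
      HasIteratedLimit (n + 1) F (fun i => -(N i : ℂ)) (recValue n (α + a) N)
  | 0, α, a, hpos, F, hF, N => by
    refine hasIteratedLimit_one ?_
    have hmem : (fun _ => -(N 0 : ℂ) : Fin 1 → ℂ) ∉ polarSet 1 := by
      have h := snoc_notMem_polarSet (s := (Fin.elim0 : Fin 0 → ℂ)) (fun j => j.elim0) (N 0)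
      convert h using 2
      funext i
      rw [Fin.eq_zero (show Fin 1 from i)]
      rfl
    have hc : ContinuousAt F fun _ => -(N 0 : ℂ) :=
      (hF.holomorphic.differentiableAt
        ((isClosed_polarSet 1).isOpen_compl.mem_nhds hmem)).continuousAt
    have hval : F (fun _ => -(N 0 : ℂ)) = (recValue 0 (α + a) N : ℝ) := by
      rw [hF.eqOn (isContinuation_one hpos) hmem]
      have h1 : (1 : ℂ) - -(N 0 : ℂ) = ((N 0 + 1 : ℕ) : ℂ) := by push_cast; ring
      have h2 : -(N 0 : ℂ) - 1 = -((N 0 + 1 : ℕ) : ℂ) := by push_cast; ring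
      beta_reduce
      rw [h1, h2, Complex.cpow_natCast, recValue, div_neg]
      push_cast
      simp
    rw [← hval]
    have hline : ContinuousAt (fun z : ℂ => (fun _ => z : Fin 1 → ℂ)) (-(N 0 : ℂ)) := by fun_prop
    exact (ContinuousAt.comp (f := fun z : ℂ => (fun _ => z : Fin 1 → ℂ)) hc hline).tendsto.mono_left
      nhdsWithin_le_nhds
  | n + 1, α, a, hpos, F, hF, N => by
    obtain ⟨G, hG⟩ := exists_isContinuation hpos.init
    refine hasIteratedLimit_of_tendsto_snoc
      (g := fun s => F (Fin.snoc s (-(N (Fin.last (n + 1)) : ℂ)) : Fin (n + 2) → ℂ)) ?_ ?_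
    -- The innermost limit: for generic outer variables the limit point is off the polar set, so `F`
    -- is continuous there.
    · refine (iterEventually_generic _).mono fun s hs => ?_
      have hc := (hF.holomorphic.differentiableAt ((isClosed_polarSet _).isOpen_compl.mem_nhds
        (snoc_notMem_polarSet hs (N (Fin.last (n + 1)))))).continuousAt
      have hline : Continuous fun z : ℂ => (Fin.snoc s z : Fin (n + 2) → ℂ) :=
        continuous_const.finSnoc continuous_id
      exact (ContinuousAt.comp (f := fun z : ℂ => (Fin.snoc s z : Fin (n + 2) → ℂ)) hc
        hline.continuousAt).tendsto.mono_left nhdsWithin_le_nhds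
    · set M := N (Fin.last (n + 1)) with hM
      set b := α (Fin.last (n + 1)) + a (Fin.last (n + 1)) with hb
      have hlim : HasIteratedLimit (n + 1)
          (fun s => -((M + 1 : ℕ) : ℂ)⁻¹ * ∑ k ∈ Finset.range (M + 2),
            (((M + 1).choose k : ℂ) * (b : ℂ) ^ k) *
              G (s + Pi.single (Fin.last n) (-(M : ℂ) - 1 + k)))
          (Fin.init fun i => -(N i : ℂ)) (recValue (n + 1) (α + a) N) := by
        have hval : ((recValue (n + 1) (α + a) N : ℝ) : ℂ) = -((M + 1 : ℕ) : ℂ)⁻¹ *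
            ∑ k ∈ Finset.range (M + 2), (((M + 1).choose k : ℂ) * (b : ℂ) ^ k) *
              ((recValue n (Fin.init α + Fin.init a : Fin (n + 1) → ℝ)
                (Fin.init N + Pi.single (Fin.last n) (M + 1 - k)) : ℝ) : ℂ) := by
          rw [recValue]
          push_cast
          rw [div_eq_inv_mul, mul_neg, neg_mul]
          rfl
        rw [hval]
        refine (HasIteratedLimit.sum _ fun k hk => ?_).const_mul _
        refine HasIteratedLimit.const_mul _ (HasIteratedLimit.comp_add ?_)
        -- Fusing shifts the limit point of the last remaining variable to -(N_{n-1} + N_n + 1 - k),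
        -- again the negative of a natural number since k ≤ N_n + 1.
        convert! IsContinuation.hasIteratedLimit hpos.init hG
          (Fin.init N + Pi.single (Fin.last n) (M + 1 - k)) using 1
        have hk' : k ≤ M + 1 := Nat.lt_succ_iff.1 (Finset.mem_range.1 hk)
        funext i
        induction i using Fin.lastCases with
        | last =>
          simp only [Pi.add_apply, Pi.single_eq_same, Fin.init]
          push_cast [Nat.cast_sub hk']
          ring
        | cast i => simp [Fin.init]
      refine hlim.congr ((iterEventually_generic _).mono fun s hs => ?_)
      rw [hF.eqOn (isContinuation_extendContinuation hpos hG) (snoc_notMem_polarSet hs M),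
        extendContinuation_of_last_eq_neg hpos hG (Fin.snoc_last _ _), neg_div, div_eq_inv_mul,
        neg_mul]
      simp only [fuse, Fin.init_snoc, Fin.snoc_last]
      rfl

/-! ### Unrolling the recursion into the explicit polynomial. -/

section ValuePoly

/-- The summand of the explicit value attached to `k`, after summation over `v`. -/
noncomputable def valueTerm (b : Fin (m + 1) → ℝ) (N k : Fin (m + 1) → ℕ) : ℝ :=
  b 0 ^ D N k 0 / D N k 0 * ∏ i : Fin m,
    ((D N k i.succ).choose (k i.succ) * b i.succ ^ k i.succ / D N k i.succ)

/-- The index set is a box and the summand a product over coordinates, so the sum factors; each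
factor is the binomial expansion of a power of α_j + a_j. -/
theorem sum_V (α a : Fin (m + 1) → ℝ) (N k : Fin (m + 1) → ℕ) :
    ∑ v ∈ V N k, A α N k v * a 0 ^ v 0 / D N k 0 *
      ∏ j ∈ Finset.Ioi (0 : Fin (m + 1)), (a j ^ v j / D N k j) = valueTerm (α + a) N k := by
  let φ : Fin (m + 1) → ℕ → ℝ := Fin.cons
    (fun v => (D N k 0).choose v * α 0 ^ (D N k 0 - v) * a 0 ^ v / D N k 0)
    (fun i v => (D N k i.succ).choose (k i.succ) * (k i.succ).choose v *
      α i.succ ^ (k i.succ - v) * (a i.succ ^ v / D N k i.succ))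
  have h1 (v : Fin (m + 1) → ℕ) : A α N k v * a 0 ^ v 0 / D N k 0 *
      ∏ j ∈ Finset.Ioi (0 : Fin (m + 1)), (a j ^ v j / D N k j) = ∏ j, φ j (v j) := by
    simp only [φ, A, Fin.prod_Ioi_zero, Fin.prod_univ_succ, Fin.cons_zero, Fin.cons_succ,
      Finset.prod_mul_distrib]
    ring
  have hbin (x y : ℝ) (n : ℕ) :
      ∑ v ∈ Finset.range (n + 1), (n.choose v : ℝ) * x ^ (n - v) * y ^ v = (x + y) ^ n := by
    rw [add_comm x y, add_pow]
    exact Finset.sum_congr rfl fun v _ => by ring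
  simp_rw [h1]
  rw [V, ← Finset.prod_univ_sum, Fin.prod_univ_succ, valueTerm]
  congr 1
  · simp only [φ, Fin.cons_zero, if_true]
    rw [← Finset.sum_div, hbin, Pi.add_apply]
  · refine Finset.prod_congr rfl fun i _ => ?_
    simp only [φ, Fin.cons_succ, Fin.succ_ne_zero, if_false]
    rw [Pi.add_apply, ← hbin, Finset.mul_sum, Finset.sum_div]
    exact Finset.sum_congr rfl fun v _ => by ring

theorem valuePoly_eq_sum_valueTerm (α a : Fin (m + 1) → ℝ) (N : Fin (m + 1) → ℕ) :
    valuePoly α N a = (-1) ^ (m + 1) * ∑ k ∈ T N, valueTerm (α + a) N k := by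
  simp only [valuePoly, sum_V]

/-- The exponents left over when the last variable is eliminated with expansion index `c`. -/
def reduceExponents (N : Fin (m + 2) → ℕ) (c : ℕ) : Fin (m + 1) → ℕ :=
  Fin.init N + Pi.single (Fin.last m) (N (Fin.last (m + 1)) + 1 - c)

theorem sum_Ici_reduceExponents (N : Fin (m + 2) → ℕ) (c : ℕ) (j : Fin (m + 1)) :
    ∑ i ∈ Finset.Ici j, reduceExponents N c i =
      ∑ i ∈ Finset.Ici j, N i.castSucc + (N (Fin.last (m + 1)) + 1 - c) := by
  have : ∑ i ∈ Finset.Ici j, (Pi.single (Fin.last m) (N (Fin.last (m + 1)) + 1 - c) :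
      Fin (m + 1) → ℕ) i = N (Fin.last (m + 1)) + 1 - c := by
    simp [Pi.single_apply, Fin.le_last]
  simp only [reduceExponents, Pi.add_apply, Finset.sum_add_distrib, this, Fin.init]

theorem D_snoc_castSucc (N : Fin (m + 2) → ℕ) (k : Fin (m + 1) → ℕ) {c : ℕ}
    (hc : c ≤ N (Fin.last (m + 1)) + 1) (j : Fin (m + 1)) :
    D N (Fin.snoc k c : Fin (m + 2) → ℕ) j.castSucc = D (reduceExponents N c) k j := by
  simp only [D, sum_Ici_castSucc, sum_Ioi_castSucc, Fin.snoc_castSucc, Fin.snoc_last,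
    sum_Ici_reduceExponents, Fin.val_castSucc]
  have := j.isLt
  omega

theorem D_last (N k : Fin (m + 1) → ℕ) : D N k (Fin.last m) = N (Fin.last m) + 1 := by
  simp [D, sum_Ici_last, sum_Ioi_last]

/-- The constraint on k_j involves only later indices, so fixing the last entry c leaves the same
kind of constraints for the reduced exponents. The bound on c keeps the truncated subtraction exact.
-/
theorem snoc_mem_T {N : Fin (m + 2) → ℕ} {k : Fin (m + 1) → ℕ} {c : ℕ} :
    (Fin.snoc k c : Fin (m + 2) → ℕ) ∈ T N ↔
      c ≤ N (Fin.last (m + 1)) + 1 ∧ k ∈ T (reduceExponents N c) := by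
  have h0 : (Fin.snoc k c : Fin (m + 2) → ℕ) 0 = k 0 := by
    rw [← Fin.castSucc_zero, Fin.snoc_castSucc]
  have hlast : Fin.last (m + 1) ≠ 0 := Fin.last_pos.ne'
  rw [mem_T, mem_T, Fin.forall_fin_succ']
  simp only [h0, ne_eq, hlast, not_false_eq_true, true_implies,
    Fin.castSucc_eq_zero_iff, sum_Ici_castSucc, sum_Ioi_castSucc, Fin.snoc_castSucc,
    Fin.snoc_last, sum_Ici_last, sum_Ioi_last, sum_Ici_reduceExponents, Fin.val_castSucc,
    Fin.val_last]
  have hsub : m + 2 - (m + 1) = 1 := by omega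
  rw [add_zero, hsub]
  constructor
  · rintro ⟨hk, h, hc⟩
    refine ⟨hc, hk, fun j hj => ?_⟩
    have h1 := h j hj
    have := j.isLt
    omega
  · rintro ⟨hc, hk, h⟩
    refine ⟨hk, fun j hj => ?_, hc⟩
    have h1 := h j hj
    have := j.isLt
    omega

theorem valueTerm_snoc (b : Fin (m + 2) → ℝ) (N : Fin (m + 2) → ℕ) (k : Fin (m + 1) → ℕ) {c : ℕ}
    (hc : c ≤ N (Fin.last (m + 1)) + 1) :
    valueTerm b N (Fin.snoc k c : Fin (m + 2) → ℕ) =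
      ((N (Fin.last (m + 1)) + 1).choose c * b (Fin.last (m + 1)) ^ c *
        valueTerm (m := m) (Fin.init b) (reduceExponents N c) k) /
          (N (Fin.last (m + 1)) + 1 : ℕ) := by
  have h0 := D_snoc_castSucc N k hc 0
  rw [Fin.castSucc_zero] at h0
  have hb0 : (Fin.init b : Fin (m + 1) → ℝ) 0 = b 0 := rfl
  rw [valueTerm, valueTerm, Fin.prod_univ_castSucc, h0, hb0]
  simp only [← Fin.castSucc_succ, D_snoc_castSucc N k hc, Fin.succ_last, D_last,
    Fin.snoc_castSucc, Fin.snoc_last, Fin.init]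
  ring

theorem sum_T_succ (N : Fin (m + 2) → ℕ) (f : (Fin (m + 2) → ℕ) → ℝ) :
    ∑ k ∈ T N, f k = ∑ c ∈ Finset.range (N (Fin.last (m + 1)) + 2),
      ∑ k ∈ T (reduceExponents N c), f (Fin.snoc k c : Fin (m + 2) → ℕ) := by
  rw [Finset.sum_sigma']
  refine Finset.sum_bij' (fun k _ => ⟨k (Fin.last (m + 1)), Fin.init k⟩)
    (fun p _ => (Fin.snoc p.2 p.1 : Fin (m + 2) → ℕ)) ?_ ?_ ?_ ?_ ?_
  · intro k hk
    rw [← Fin.snoc_init_self k, snoc_mem_T] at hk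
    simpa [Nat.lt_succ_iff] using hk
  · rintro ⟨c, k⟩ hp
    rw [snoc_mem_T]
    simpa [Nat.lt_succ_iff] using hp
  · intro k _
    exact Fin.snoc_init_self k
  · rintro ⟨c, k⟩ _
    simp
  · intro k _
    simp

/-- Both sides obey the same recursion: T(N) fibres over its last entry, and each term splits off
the factor of the last variable. -/
theorem recValue_eq : ∀ {m : ℕ} (b : Fin (m + 1) → ℝ) (N : Fin (m + 1) → ℕ),
    recValue m b N = (-1) ^ (m + 1) * ∑ k ∈ T N, valueTerm b N k
  | 0, b, N => by
    have hT : T N = {0} := by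
      ext k
      rw [mem_T, Finset.mem_singleton]
      refine ⟨fun h => ?_, fun h => ⟨by rw [h]; rfl, fun j hj => absurd (Fin.eq_zero j) hj⟩⟩
      funext i
      rw [Fin.eq_zero i, h.1]
      rfl
    have hD : D N 0 0 = N 0 + 1 := D_last N 0
    rw [hT, Finset.sum_singleton, recValue, valueTerm, hD]
    simp
  | m + 1, b, N => by
    rw [recValue, sum_T_succ, neg_div, Finset.sum_div, pow_succ, mul_neg_one, neg_mul, neg_inj,
      Finset.mul_sum]
    refine Finset.sum_congr rfl fun c hc => ?_
    have hc' : c ≤ N (Fin.last (m + 1)) + 1 := Nat.lt_succ_iff.1 (Finset.mem_range.1 hc)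
    rw [Finset.sum_congr rfl fun k _ => valueTerm_snoc b N k hc', ← Finset.sum_div,
      ← Finset.mul_sum, recValue_eq (Fin.init b), reduceExponents]
    ring

theorem recValue_eq_valuePoly (α a : Fin (m + 1) → ℝ) (N : Fin (m + 1) → ℕ) :
    recValue m (α + a) N = valuePoly α N a := by
  rw [recValue_eq, valuePoly_eq_sum_valueTerm]

end ValuePoly

end ShiftedIntegral

theorem proposition3 (n : ℕ) [NeZero n] (α a : Fin n → ℝ) (N : Fin n → ℕ)
    (ha : ∀ i, 0 ≤ a i)
    (hpos : ∀ i, 0 < ∑ j ∈ Finset.Iic i, (α j + a j)) :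
    (∀ s ∈ ShiftedIntegral.convergenceRegion n,
      MeasureTheory.IntegrableOn (ShiftedIntegral.integrand a s) (Set.Ici α)) ∧
    (∃ F : (Fin n → ℂ) → ℂ, ShiftedIntegral.IsContinuation α a F) ∧
    (∀ F : (Fin n → ℂ) → ℂ, ShiftedIntegral.IsContinuation α a F →
      ShiftedIntegral.HasIteratedLimit n F (fun i => -(N i : ℂ))
        ((ShiftedIntegral.valuePoly α N a : ℝ) : ℂ)) := by
  obtain ⟨m, rfl⟩ := Nat.exists_eq_succ_of_ne_zero (NeZero.ne n)
  refine ⟨fun s hs => ShiftedIntegral.integrableOn_integrand hpos hs,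
    ShiftedIntegral.exists_isContinuation hpos, fun F hF => ?_⟩
  have h := hF.hasIteratedLimit hpos N
  rwa [ShiftedIntegral.recValue_eq_valuePoly] at h
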